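/- Let $q_0,q_1,q_2$ be the vertices of an equilateral triangle of height $1$ with $q_0$ at the top and $q_1,q_2$ on a horizontal base line, $F_i(p)=\frac12(p+q_i)$, and let $\mathcal{SG}$ be the Sierpinski gasket, $\mathcal{SG}=\bigcup_i F_i(\mathcal{SG})$. An $m$-cell is a set $F_w(\mathcal{SG})$ with $F_w=F_{w_1}\circ\cdots\circ F_{w_m}$, $w\in\{0,1,2\}^m$. For a set $A\subseteq\mathcal{SG}$ and a function $u:A\to\mathbb R$ put $$\mathcal E_A(u)=\lim_{m\to\infty}\left(\tfrac53\right)^m\sum_{|w|=m,\ F_w(\mathcal{SG})\subseteq A}\ \sum_{0\le i<j\le 2}\bigl(u(F_wq_i)-u(F_wq_j)\bigr)^2\in[0,\infty]$$ (a nondecreasing limit), and let $\mathrm{dom}_A(\mathcal E)$ be the space of continuous $u:A\to\mathbb R$ with $\mathcal E_A(u)<\infty$. Let $0<x\le 1$ and let $x=\sum_{k\ge1}2^{-n_k}$, $0<n_1<n_2<\cdots$ integers, be its unique infinite binary expansion. Let $\Omega_x^+$ be the set of points of $\mathcal{SG}$ lying strictly above the horizontal line at distance $x$ below $q_0$. Say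 that $x$ satisfies the nonconsecutive condition with bound $N$ if there are no $N$ consecutive integers among the $n_k$, and that it satisfies the nonconsecutive condition if it does so with some bound $N\in\mathbb N$. A bounded linear extension operator is a linear map $T:\mathrm{dom}_{\Omega_x^+}(\mathcal E)\to\mathrm{dom}_{\mathcal{SG}}(\mathcal E)$ with $Tu|_{\Omega_x^+}=u$ for all $u$, for which there is a constant $M$ with $\mathcal E_{\mathcal{SG}}(Tu)^{1/2}\le M\,\mathcal E_{\Omega_x^+}(u)^{1/2}$ for all $u$; the operator then has bound $M$. **Theorem 4.6.** For every $x\in(0,1]$, a bounded linear extension operator exists if and only if $x$ satisfies the nonconsecutive condition. Moreover, there is an absolute constant $C>0$, independent of $x$ and $N$, such that whenever $x$ satisfies the nonconsecutive condition with bound $N$, there is a linear extension operator $T:\mathrm{dom}_{\Omega_x^+}(\mathcal E)\to\mathrm{dom}_{\mathcal{SG}}(\mathcal E)$ with bound $C\left(\frac{10}{3}\right)^{N/2}$. -/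

import Mathlib

namespace Gasket

/-- The Euclidean plane. -/
abbrev Plane : Type := EuclideanSpace ℝ (Fin 2)

/-- The vertices of an equilateral triangle of height `1`; `q 0` is the top vertex. -/
noncomputable def q : Fin 3 → Plane :=
  ![!₂[0, 1], !₂[-1 / √3, 0], !₂[1 / √3, 0]]

/-- The contraction of ratio `1/2` with fixed point `q i`. -/
noncomputable def F (i : Fin 3) (p : Plane) : Plane := (1 / 2 : ℝ) • (p + q i)

/-- `cellMap [w₁, …, wₘ] = F w₁ ∘ ⋯ ∘ F wₘ`. -/
noncomputable def cellMap : List (Fin 3) → Plane → Plane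
  | [] => id
  | i :: w => F i ∘ cellMap w

/-- The Sierpinski gasket: the closure of the set of all vertices `F_w q_i`. It is the nonempty
compact set `K` with `K = F 0 '' K ∪ F 1 '' K ∪ F 2 '' K`. -/
def SG : Set Plane := closure {p | ∃ (w : List (Fin 3)) (i : Fin 3), p = cellMap w (q i)}

/-- The cell `F_w(SG)`, of order the length of `w`. -/
def cell (w : List (Fin 3)) : Set Plane := cellMap w '' SG

theorem q_mem_SG (i : Fin 3) : q i ∈ SG := subset_closure ⟨[], i, rfl⟩

theorem vertex_mem_cell (w : List (Fin 3)) (i : Fin 3) : cellMap w (q i) ∈ cell w :=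
  ⟨q i, q_mem_SG i, rfl⟩

/-- The points of the gasket strictly above the horizontal line at distance `x` below `q 0`. -/
def Omega (x : ℝ) : Set Plane := {p | p ∈ SG ∧ 1 - x < p 1}

/-- The sum of the squared differences of `u` along the three edges of the cell of `w`
(counted only if the cell lies in the domain `A` of `u`). -/
noncomputable def cellEnergy (A : Set Plane) (u : A → ℝ) (w : List (Fin 3)) : ℝ :=
  open Classical in
  if h : cell w ⊆ A then
    (u ⟨cellMap w (q 0), h (vertex_mem_cell w 0)⟩
        - u ⟨cellMap w (q 1), h (vertex_mem_cell w 1)⟩) ^ 2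
    + (u ⟨cellMap w (q 1), h (vertex_mem_cell w 1)⟩
        - u ⟨cellMap w (q 2), h (vertex_mem_cell w 2)⟩) ^ 2
    + (u ⟨cellMap w (q 2), h (vertex_mem_cell w 2)⟩
        - u ⟨cellMap w (q 0), h (vertex_mem_cell w 0)⟩) ^ 2
  else 0

/-- The renormalized graph energy of level `m`, over the cells of order `m` contained in `A`. -/
noncomputable def graphEnergy (A : Set Plane) (u : A → ℝ) (m : ℕ) : ℝ :=
  (5 / 3 : ℝ) ^ m * ∑ w : Fin m → Fin 3, cellEnergy A u (List.ofFn w)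

/-- The energy of `u` on `A`, the limit of the graph energies, which are nondecreasing in `m`.
For `A = SG` this is the standard energy on the gasket, for `A = Omega x` the energy on
the domain above the line. -/
noncomputable def energy (A : Set Plane) (u : A → ℝ) : ENNReal :=
  ⨆ m : ℕ, ENNReal.ofReal (graphEnergy A u m)

theorem cellEnergy_nonneg (A : Set Plane) (u : A → ℝ) (w : List (Fin 3)) :
    0 ≤ cellEnergy A u w := by
  unfold cellEnergy
  split_ifs
  · positivity
  · exact le_rfl

theorem graphEnergy_nonneg (A : Set Plane) (u : A → ℝ) (m : ℕ) : 0 ≤ graphEnergy A u m :=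
  mul_nonneg (by positivity) (Finset.sum_nonneg fun _ _ => cellEnergy_nonneg A u _)

theorem graphEnergy_add_le (A : Set Plane) (u v : A → ℝ) (m : ℕ) :
    graphEnergy A (u + v) m ≤ 2 * graphEnergy A u m + 2 * graphEnergy A v m := by
  have key : ∀ w, cellEnergy A (u + v) w ≤ 2 * cellEnergy A u w + 2 * cellEnergy A v w := by
    intro w
    unfold cellEnergy
    split_ifs with h
    · have aux : ∀ a b c d : ℝ,
          (a + b - (c + d)) ^ 2 ≤ 2 * (a - c) ^ 2 + 2 * (b - d) ^ 2 := fun a b c d => by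
        nlinarith [sq_nonneg ((a - c) - (b - d))]
      simp only [Pi.add_apply]
      refine (add_le_add (add_le_add (aux _ _ _ _) (aux _ _ _ _)) (aux _ _ _ _)).trans_eq ?_
      ring
    · simp
  unfold graphEnergy
  calc _ ≤ (5 / 3 : ℝ) ^ m * ∑ w : Fin m → Fin 3,
        (2 * cellEnergy A u (List.ofFn w) + 2 * cellEnergy A v (List.ofFn w)) := by
        gcongr with w
        exact key _
    _ = _ := by
        rw [Finset.sum_add_distrib, ← Finset.mul_sum, ← Finset.mul_sum]
        ring

theorem graphEnergy_smul (A : Set Plane) (c : ℝ) (u : A → ℝ) (m : ℕ) :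
    graphEnergy A (c • u) m = c ^ 2 * graphEnergy A u m := by
  have key : ∀ w, cellEnergy A (c • u) w = c ^ 2 * cellEnergy A u w := by
    intro w
    unfold cellEnergy
    split_ifs with h
    · simp only [Pi.smul_apply, smul_eq_mul]
      ring
    · simp
  unfold graphEnergy
  simp only [key, ← Finset.mul_sum]
  ring

/-- The space of continuous functions of finite energy on `A`. -/
noncomputable def domE (A : Set Plane) : Submodule ℝ C(A, ℝ) where
  carrier := {u | energy A u < ⊤}
  zero_mem' := by
    have h : ∀ m, graphEnergy A (0 : A → ℝ) m = 0 := fun m => by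
      simpa using graphEnergy_smul A 0 0 m
    simp [energy, h]
  add_mem' := by
    intro u v hu hv
    refine lt_of_le_of_lt (b := 2 * energy A u + 2 * energy A v) (iSup_le fun m => ?_)
      (ENNReal.add_lt_top.2 ⟨ENNReal.mul_lt_top (by simp) hu, ENNReal.mul_lt_top (by simp) hv⟩)
    refine (ENNReal.ofReal_le_ofReal (graphEnergy_add_le A u v m)).trans ?_
    have h1 := graphEnergy_nonneg A u m
    have h2 := graphEnergy_nonneg A v m
    rw [ENNReal.ofReal_add (by positivity) (by positivity), ENNReal.ofReal_mul (by norm_num),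
      ENNReal.ofReal_mul (by norm_num), ENNReal.ofReal_ofNat]
    unfold energy
    gcongr
    · exact le_iSup (fun m => ENNReal.ofReal (graphEnergy A u m)) m
    · exact le_iSup (fun m => ENNReal.ofReal (graphEnergy A v m)) m
  smul_mem' := by
    intro c u hu
    refine lt_of_le_of_lt (b := ENNReal.ofReal (c ^ 2) * energy A u) (iSup_le fun m => ?_)
      (ENNReal.mul_lt_top ENNReal.ofReal_lt_top hu)
    rw [ContinuousMap.coe_smul, graphEnergy_smul, ENNReal.ofReal_mul (by positivity)]
    unfold energy
    gcongr
    exact le_iSup (fun m => ENNReal.ofReal (graphEnergy A u m)) m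

/-- The energy seminorm, the square root of the (finite) energy. -/
noncomputable def energySeminorm {A : Set Plane} (u : domE A) : ℝ :=
  √(energy A (u : C(A, ℝ))).toReal

/-- `T u` restricts to `u` on `Omega x`. -/
def IsExtensionOperator {x : ℝ} (T : domE (Omega x) →ₗ[ℝ] domE SG) : Prop :=
  ∀ (u : domE (Omega x)) (p : Plane) (hp : p ∈ Omega x),
    (T u : C(SG, ℝ)) ⟨p, hp.1⟩ = (u : C(Omega x, ℝ)) ⟨p, hp⟩

/-- The operator norm of `T` with respect to the energy seminorms is at most `M`. -/
def IsBoundedBy {x : ℝ} (T : domE (Omega x) →ₗ[ℝ] domE SG) (M : ℝ) : Prop :=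
  ∀ u : domE (Omega x), energySeminorm (T u) ≤ M * energySeminorm u

/-- `x = ∑ 2 ^ (-n_k)` with `0 < n_1 < n_2 < ⋯` (here indexed from `0`): the infinite binary
expansion of `x`. Each `x` in `(0, 1]` has exactly one. -/
structure IsBinaryExpansion (n : ℕ → ℕ) (x : ℝ) : Prop where
  pos : 0 < n 0
  strictMono : StrictMono n
  hasSum : HasSum (fun k => ((2 : ℝ) ^ n k)⁻¹) x

/-- There are no `N` consecutive integers among the `n_k`. -/
def Nonconsecutive (n : ℕ → ℕ) (N : ℕ) : Prop :=
  ¬ ∃ a : ℕ, ∀ i < N, a + i ∈ Set.range n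

end Gasket

/-!
The digits of `x` describe `Omega x` recursively: if the first digit is `1`, then `Omega x` is
the whole top subcell together with a copy of `Omega (dbl x)` in each of the two others, and if it
is `0`, then `Omega x` is a copy of `Omega (dbl x)` in the top subcell. Energies on `Omega x` and
on the gasket satisfy the corresponding recursions, so the estimates are inductions on the level
of the graph energy, with `x` replaced by `dbl x` and `u` by `u ∘ F i`.

Functions on the gasket are built from their values at vertices: values of bounded energy, with
the obvious compatibility, oscillate by `O((3/5) ^ (m/2))` on cells of order `m`, and distinct
cells of the same order meet only in vertices, so these values extend continuously
(`Compatible.exists_continuous`).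

*Sufficiency.* The extension `extData` has equal values `c` at the two bottom vertices. During a
run of digits `1` the value `c` is kept. At a digit `0`, `c` is reset to the value of `u` at the
top vertex of the current cell, and harmonic functions in the two free subcells join the new value
to the old one. A jump made after `r` digits `1` takes place in `2 ^ r` cells with conductance
`(5/3) ^ r`, hence costs `(10/3) ^ r` times the squared jump, and the jump is controlled by the
energy of `u` along the chains of cells leading to that level (`dataEnergy_extData_le`).

*Necessity.* If `n + 1` consecutive digits are `1`, then inside one cell the function which is `1`
on the left part of the domain and `-1` on the right part has bounded relative energy, but both
values occur in two cells, smaller by `n + 1` orders, that share a vertex on the bottom line, so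
that every extension has energy larger by a factor of order `(5/3) ^ n` (`exists_steep`). Long
runs therefore exclude a bounded extension operator.
-/

namespace Gasket

/-! ### Barycentric coordinates and the cell structure -/

/-- The barycentric coordinates with respect to `q 0, q 1, q 2`. -/
noncomputable def bary (i : Fin 3) (p : Plane) : ℝ :=
  ![p 1, (1 - p 1 - √3 * p 0) / 2, (1 - p 1 + √3 * p 0) / 2] i

theorem bary_F (i j : Fin 3) (p : Plane) :
    bary i (F j p) = (bary i p + if i = j then 1 else 0) / 2 := by
  have h3 : √3 * (√3)⁻¹ = 1 := mul_inv_cancel₀ (by positivity)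
  fin_cases i <;> fin_cases j <;> simp [bary, F, q, neg_div] <;> linarith

theorem bary_q (i j : Fin 3) : bary i (q j) = if i = j then 1 else 0 := by
  fin_cases i <;> fin_cases j <;> simp [bary, q, neg_div]

theorem sum_bary (p : Plane) : bary 0 p + bary 1 p + bary 2 p = 1 := by
  simp [bary]; ring

theorem bary_injective {p p' : Plane} (h : ∀ i, bary i p = bary i p') : p = p' := by
  have h0 := h 0
  have h1 := h 1
  have h2 := h 2
  simp only [bary, Matrix.cons_val] at h0 h1 h2
  have h3 : √3 * p 0 = √3 * p' 0 := by linarith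
  have h4 := mul_left_cancel₀ (by positivity) h3
  ext i
  fin_cases i <;> assumption

theorem continuous_bary (i : Fin 3) : Continuous (bary i) := by
  unfold bary
  fin_cases i <;> simp <;> fun_prop

theorem F_injective (i : Fin 3) : Function.Injective (F i) := fun p p' h => by
  simpa [F] using h

/-- The expansion inverse to `F i`. -/
noncomputable def invF (i : Fin 3) (p : Plane) : Plane := (2 : ℝ) • p - q i

theorem invF_F (i : Fin 3) (p : Plane) : invF i (F i p) = p := by
  simp [invF, F, smul_smul]

theorem F_invF (i : Fin 3) (p : Plane) : F i (invF i p) = p := by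
  simp [invF, F, smul_smul]

theorem continuous_F (i : Fin 3) : Continuous (F i) := by unfold F; fun_prop

theorem continuous_invF (i : Fin 3) : Continuous (invF i) := by unfold invF; fun_prop

/-- `F i` as a homeomorphism of the plane. -/
noncomputable def homeoF (i : Fin 3) : Plane ≃ₜ Plane where
  toFun := F i
  invFun := invF i
  left_inv := invF_F i
  right_inv := F_invF i
  continuous_toFun := continuous_F i
  continuous_invFun := continuous_invF i

theorem F_q_self (i : Fin 3) : F i (q i) = q i := by
  simp [F, ← two_smul ℝ (q i), smul_smul]

theorem F_q_comm (i j : Fin 3) : F i (q j) = F j (q i) := by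
  simp [F, add_comm]

/-- The set of all vertices of cells. -/
def Vert : Set Plane := {p | ∃ (w : List (Fin 3)) (i : Fin 3), p = cellMap w (q i)}

theorem SG_eq : SG = closure Vert := rfl

theorem Vert_subset : Vert ⊆ SG := subset_closure

theorem isClosed_SG : IsClosed SG := isClosed_closure

theorem F_mem_SG (i : Fin 3) {p : Plane} (hp : p ∈ SG) : F i p ∈ SG := by
  refine map_mem_closure (continuous_F i) hp ?_
  rintro _ ⟨w, j, rfl⟩
  exact ⟨i :: w, j, rfl⟩

theorem cellMap_mem_SG (w : List (Fin 3)) {p : Plane} (hp : p ∈ SG) : cellMap w p ∈ SG := by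
  induction w with
  | nil => exact hp
  | cons i w ih => exact F_mem_SG i ih

theorem cell_subset (w : List (Fin 3)) : cell w ⊆ SG := by
  rintro _ ⟨p, hp, rfl⟩
  exact cellMap_mem_SG w hp

theorem cellMap_q_mem (w : List (Fin 3)) (i : Fin 3) : cellMap w (q i) ∈ SG :=
  cellMap_mem_SG w (q_mem_SG i)

theorem cellMap_append (w v : List (Fin 3)) (p : Plane) :
    cellMap (w ++ v) p = cellMap w (cellMap v p) := by
  induction w with
  | nil => rfl
  | cons i w ih => exact congrArg (F i) ih

theorem cell_cons (i : Fin 3) (w : List (Fin 3)) : cell (i :: w) = F i '' cell w := by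
  simp only [cell, cellMap, Set.image_comp]

theorem isClosed_cell (w : List (Fin 3)) : IsClosed (cell w) := by
  induction w with
  | nil => simpa [cell, cellMap] using isClosed_SG
  | cons i w ih =>
    rw [cell_cons]
    exact (homeoF i).isClosedMap _ ih

theorem exists_F_of_mem_SG {p : Plane} (hp : p ∈ SG) : ∃ i, ∃ p' ∈ SG, F i p' = p := by
  have hcl : IsClosed (⋃ i, F i '' SG) :=
    isClosed_iUnion_of_finite fun i => (homeoF i).isClosedMap _ isClosed_SG
  have hsub : Vert ⊆ ⋃ i, F i '' SG := by
    rintro _ ⟨w, j, rfl⟩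
    cases w with
    | nil => exact Set.mem_iUnion.2 ⟨j, q j, q_mem_SG j, F_q_self j⟩
    | cons i w => exact Set.mem_iUnion.2 ⟨i, _, cellMap_q_mem w j, rfl⟩
  obtain ⟨i, p', h, h'⟩ := Set.mem_iUnion.1 (closure_minimal hsub hcl hp)
  exact ⟨i, p', h, h'⟩

theorem bary_nonneg (i : Fin 3) {p : Plane} (hp : p ∈ SG) : 0 ≤ bary i p := by
  have hV : ∀ (w : List (Fin 3)) (j : Fin 3), 0 ≤ bary i (cellMap w (q j)) := by
    intro w j
    induction w with
    | nil =>
      change 0 ≤ bary i (q j)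
      rw [bary_q]
      split_ifs <;> norm_num
    | cons k w ih =>
      change 0 ≤ bary i (F k (cellMap w (q j)))
      rw [bary_F]
      split_ifs <;> linarith
  refine closure_minimal (s := Vert) (t := {p | 0 ≤ bary i p}) ?_
    (isClosed_le continuous_const (continuous_bary i)) hp
  rintro _ ⟨w, j, rfl⟩
  exact hV w j

theorem eq_q_of_one_le_bary {i : Fin 3} {p : Plane} (hp : p ∈ SG) (h : 1 ≤ bary i p) :
    p = q i := by
  have h0 := bary_nonneg 0 hp
  have h1 := bary_nonneg 1 hp
  have h2 := bary_nonneg 2 hp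
  have hs := sum_bary p
  refine bary_injective fun j => ?_
  rw [bary_q]
  fin_cases i <;> fin_cases j <;> simp at h ⊢ <;> linarith

theorem bary_zero_le_one {p : Plane} (hp : p ∈ SG) : bary 0 p ≤ 1 := by
  linarith [bary_nonneg 1 hp, bary_nonneg 2 hp, sum_bary p]

/-- Two different cells of order `1` meet only in the midpoint of a side. -/
theorem eq_q_of_F_eq_F {i j : Fin 3} (hij : i ≠ j) {p p' : Plane} (hp : p ∈ SG) (hp' : p' ∈ SG)
    (h : F i p = F j p') : p = q j ∧ p' = q i := by
  have h1 := congrArg (bary i) h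
  have h2 := congrArg (bary j) h
  simp only [bary_F, if_true, if_neg hij, if_neg hij.symm] at h1 h2
  exact ⟨eq_q_of_one_le_bary hp (by linarith [bary_nonneg j hp']),
    eq_q_of_one_le_bary hp' (by linarith [bary_nonneg i hp])⟩

theorem q_eq_of_mem_cell {j : Fin 3} {w : List (Fin 3)} (h : q j ∈ cell w) :
    q j = cellMap w (q j) := by
  induction w with
  | nil => rfl
  | cons i w ih =>
    rw [cell_cons] at h
    obtain ⟨p, hp, hpq⟩ := h
    have hb := congrArg (bary j) hpq
    rw [bary_F, bary_q, if_pos rfl] at hb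
    have hp1 : 1 ≤ bary j p := by split_ifs at hb <;> linarith
    have hpj := eq_q_of_one_le_bary (cell_subset w hp) hp1
    subst hpj
    change q j = F i (cellMap w (q j))
    rw [← ih hp, hpq]

/-- Different cells of the same order meet only in common vertices. -/
theorem eq_vertex_of_mem_cells {w v : List (Fin 3)} (hl : w.length = v.length) (hne : w ≠ v)
    {p : Plane} (hw : p ∈ cell w) (hv : p ∈ cell v) :
    ∃ i j, p = cellMap w (q i) ∧ p = cellMap v (q j) := by
  induction w generalizing v p with
  | nil => exact absurd (List.eq_nil_of_length_eq_zero hl.symm).symm hne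
  | cons i w ih =>
    cases v with
    | nil => simp at hl
    | cons j v =>
      rw [cell_cons] at hw hv
      obtain ⟨r, hr, rfl⟩ := hw
      obtain ⟨s, hs, hrs⟩ := hv
      by_cases hij : i = j
      · subst hij
        obtain rfl := F_injective i hrs
        obtain ⟨k, l, h1, h2⟩ := ih (by simpa using hl) (fun h => hne (by rw [h])) hr hs
        exact ⟨k, l, congrArg (F i) h1, congrArg (F i) h2⟩
      · obtain ⟨h1, h2⟩ := eq_q_of_F_eq_F hij (cell_subset w hr) (cell_subset v hs) hrs.symm
        subst h1 h2
        exact ⟨j, i, congrArg (F i) (q_eq_of_mem_cell hr),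
          by rw [← hrs]; exact congrArg (F j) (q_eq_of_mem_cell hs)⟩

theorem cellMap_replicate (i : Fin 3) (m : ℕ) : cellMap (List.replicate m i) (q i) = q i := by
  induction m with
  | zero => rfl
  | succ m ih =>
    change F i (cellMap (List.replicate m i) (q i)) = q i
    rw [ih, F_q_self]

theorem q_injective : Function.Injective q := fun i j h => by
  have := congrArg (bary i) h
  by_contra hij
  simp [bary_q, hij] at this

/-- Functions given on the three cells of order `1` of a subset of the gasket, compatible at the
common vertices that belong to the set, come from one function. -/
theorem exists_glue (A : Fin 3 → Set Plane) (hA : ∀ i, A i ⊆ SG) (f : Fin 3 → Plane → ℝ)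
    (hf : ∀ i j, q j ∈ A i → q i ∈ A j → f i (q j) = f j (q i)) :
    ∃ g : Plane → ℝ, ∀ i, ∀ p ∈ A i, g (F i p) = f i p := by
  classical
  refine ⟨fun z => if h : ∃ i, ∃ p ∈ A i, F i p = z then f h.choose h.choose_spec.choose else 0,
    fun i p hp => ?_⟩
  have h : ∃ j, ∃ p' ∈ A j, F j p' = F i p := ⟨i, p, hp, rfl⟩
  simp only [dif_pos h]
  obtain ⟨h1, h2⟩ := h.choose_spec.choose_spec
  generalize h.choose_spec.choose = p' at h1 h2
  generalize h.choose = j at h1 h2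
  by_cases hij : j = i
  · subst hij
    rw [F_injective j h2]
  · obtain ⟨e1, e2⟩ := eq_q_of_F_eq_F hij (hA _ h1) (hA _ hp) h2
    subst e1 e2
    exact hf _ _ h1 hp

/-- Continuity on a subset of the gasket can be tested on the three cells of order `1`. -/
theorem continuousOn_of_comp_F {A : Set Plane} (hA : A ⊆ SG) {f : Plane → ℝ}
    (hf : ∀ i, ContinuousOn (f ∘ F i) (F i ⁻¹' A ∩ SG)) : ContinuousOn f A := by
  intro p hp
  have hpiece : ∀ i, ContinuousWithinAt f (A ∩ F i '' SG) p := by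
    intro i
    by_cases hpi : p ∈ F i '' SG
    · have hmaps : Set.MapsTo (invF i) (A ∩ F i '' SG) (F i ⁻¹' A ∩ SG) := by
        rintro _ ⟨hz, z, hzS, rfl⟩
        rw [invF_F]
        exact ⟨hz, hzS⟩
      have hc := (hf i).comp (continuous_invF i).continuousOn hmaps
      refine (hc.congr fun z _ => ?_) p ⟨hp, hpi⟩
      simp [F_invF]
    · refine continuousWithinAt_of_notMem_closure fun h => hpi ?_
      have hcl : IsClosed (F i '' SG) := (homeoF i).isClosedMap _ isClosed_SG
      exact closure_minimal Set.inter_subset_right hcl h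
  refine (((hpiece 0).union (hpiece 1)).union (hpiece 2)).mono fun z hz => ?_
  obtain ⟨i, z', hz', rfl⟩ := exists_F_of_mem_SG (hA hz)
  fin_cases i
  · exact Or.inl (Or.inl ⟨hz, z', hz', rfl⟩)
  · exact Or.inl (Or.inr ⟨hz, z', hz', rfl⟩)
  · exact Or.inr ⟨hz, z', hz', rfl⟩

/-! ### The domains and the doubling map -/

/-- The doubling map of `(0, 1]` for which `1 / 2 < x` says that the first digit of the infinite
binary expansion of `x` is `1`, and which deletes this digit. -/
noncomputable def dbl (x : ℝ) : ℝ := if 1 / 2 < x then 2 * x - 1 else 2 * x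

theorem dbl_pos {x : ℝ} (hx : 0 < x) : 0 < dbl x := by
  unfold dbl; split_ifs <;> linarith

theorem dbl_le_one {x : ℝ} (hx : x ≤ 1) : dbl x ≤ 1 := by
  unfold dbl; split_ifs <;> linarith

theorem mem_Omega {x : ℝ} {p : Plane} : p ∈ Omega x ↔ p ∈ SG ∧ 1 - x < bary 0 p := Iff.rfl

theorem F_zero_mem_Omega {x : ℝ} (hx : 1 / 2 < x) {p : Plane} (hp : p ∈ SG) :
    F 0 p ∈ Omega x := by
  rw [mem_Omega, bary_F, if_pos rfl]
  exact ⟨F_mem_SG 0 hp, by linarith [bary_nonneg 0 hp]⟩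

theorem F_mem_Omega_iff {x : ℝ} (hx : 1 / 2 < x) {i : Fin 3} (hi : i ≠ 0) {p : Plane}
    (hp : p ∈ SG) : F i p ∈ Omega x ↔ p ∈ Omega (dbl x) := by
  rw [mem_Omega, mem_Omega, bary_F, if_neg hi.symm, dbl, if_pos hx]
  constructor
  · rintro ⟨_, h⟩
    exact ⟨hp, by linarith⟩
  · rintro ⟨_, h⟩
    exact ⟨F_mem_SG i hp, by linarith⟩

theorem F_zero_mem_Omega_iff {x : ℝ} (hx : ¬ 1 / 2 < x) {p : Plane}
    (hp : p ∈ SG) : F 0 p ∈ Omega x ↔ p ∈ Omega (dbl x) := by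
  rw [mem_Omega, mem_Omega, bary_F, if_pos rfl, dbl, if_neg hx]
  constructor
  · rintro ⟨_, h⟩
    exact ⟨hp, by linarith⟩
  · rintro ⟨_, h⟩
    exact ⟨F_mem_SG 0 hp, by linarith⟩

theorem F_notMem_Omega {x : ℝ} (hx : ¬ 1 / 2 < x) {i : Fin 3} (hi : i ≠ 0) {p : Plane}
    (hp : p ∈ SG) : F i p ∉ Omega x := by
  rw [mem_Omega, bary_F, if_neg hi.symm]
  rintro ⟨_, h⟩
  linarith [bary_zero_le_one hp]

theorem q_notMem_Omega {x : ℝ} (hx : x ≤ 1) {i : Fin 3} (hi : i ≠ 0) : q i ∉ Omega x := by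
  rw [mem_Omega, bary_q, if_neg hi.symm]
  rintro ⟨_, h⟩
  linarith

theorem q_zero_mem_Omega {x : ℝ} (hx : 0 < x) : q 0 ∈ Omega x := by
  rw [mem_Omega, bary_q, if_pos rfl]
  exact ⟨q_mem_SG 0, by linarith⟩

theorem Omega_subset (x : ℝ) : Omega x ⊆ SG := fun _ h => h.1

theorem le_of_strictMono {n : ℕ → ℕ} (hn : StrictMono n) (k : ℕ) : n 0 + k ≤ n k := by
  induction k with
  | zero => exact le_rfl
  | succ k ih => have := hn (Nat.lt_add_one k); omega

theorem IsBinaryExpansion.le {n : ℕ → ℕ} {x : ℝ} (h : IsBinaryExpansion n x) :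
    x ≤ 2 * ((2 : ℝ) ^ n 0)⁻¹ := by
  have hg : HasSum (fun k : ℕ => ((2 : ℝ) ^ n 0)⁻¹ * (1 / 2 : ℝ) ^ k)
      (((2 : ℝ) ^ n 0)⁻¹ * 2) := hasSum_geometric_two.mul_left _
  rw [mul_comm]
  refine hasSum_le (fun k => ?_) h.hasSum hg
  rw [one_div, inv_pow, ← mul_inv, ← pow_add]
  gcongr
  · norm_num
  · exact le_of_strictMono h.strictMono k

theorem IsBinaryExpansion.lt {n : ℕ → ℕ} {x : ℝ} (h : IsBinaryExpansion n x) :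
    ((2 : ℝ) ^ n 0)⁻¹ < x := by
  have h1 := sum_le_hasSum (Finset.range 2) (fun i _ => by positivity) h.hasSum
  rw [Finset.sum_range_succ, Finset.sum_range_one] at h1
  have : (0 : ℝ) < ((2 : ℝ) ^ n 1)⁻¹ := by positivity
  linarith

theorem IsBinaryExpansion.le_one {n : ℕ → ℕ} {x : ℝ} (h : IsBinaryExpansion n x) : x ≤ 1 := by
  refine h.le.trans ?_
  have : (2 : ℝ) ^ 1 ≤ 2 ^ n 0 := pow_le_pow_right₀ (by norm_num) h.pos
  rw [← div_eq_mul_inv, div_le_one (by positivity)]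
  simpa using this

theorem IsBinaryExpansion.x_pos {n : ℕ → ℕ} {x : ℝ} (h : IsBinaryExpansion n x) : 0 < x :=
  lt_trans (by positivity) h.lt

theorem IsBinaryExpansion.half_lt_iff {n : ℕ → ℕ} {x : ℝ} (h : IsBinaryExpansion n x) :
    1 / 2 < x ↔ n 0 = 1 := by
  constructor
  · intro hx
    by_contra hne
    have h2 : 2 ≤ n 0 := by have := h.pos; omega
    have : (2 : ℝ) ^ 2 ≤ 2 ^ n 0 := pow_le_pow_right₀ (by norm_num) h2
    have h3 : ((2 : ℝ) ^ n 0)⁻¹ ≤ (2 ^ 2)⁻¹ := inv_anti₀ (by norm_num) this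
    have := h.le
    norm_num at h3
    linarith
  · intro h1
    have := h.lt
    rw [h1] at this
    norm_num at this
    simpa using this

theorem two_mul_inv_pow {m : ℕ} (hm : 0 < m) :
    2 * ((2 : ℝ) ^ m)⁻¹ = ((2 : ℝ) ^ (m - 1))⁻¹ := by
  obtain ⟨m, rfl⟩ := Nat.exists_eq_succ_of_ne_zero hm.ne'
  rw [Nat.succ_sub_one, pow_succ, mul_inv]
  ring

/-- The doubling map shifts the binary expansion. -/
theorem IsBinaryExpansion.exists_dbl {n : ℕ → ℕ} {x : ℝ} (h : IsBinaryExpansion n x) :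
    ∃ n', IsBinaryExpansion n' (dbl x) ∧ ∀ k, k + 2 ∈ Set.range n ↔ k + 1 ∈ Set.range n' := by
  have hpos : ∀ k, 0 < n k := fun k => by
    have := le_of_strictMono h.strictMono k
    have := h.pos
    omega
  by_cases h1 : n 0 = 1
  · have hlt : ∀ k, 1 < n (k + 1) := fun k => by
      have := h.strictMono (Nat.succ_pos k)
      rw [h1] at this
      exact this
    refine ⟨fun k => n (k + 1) - 1, ⟨?_, ?_, ?_⟩, fun k => ?_⟩
    · have := hlt 0
      omega
    · intro a b hab
      have := h.strictMono (Nat.succ_lt_succ hab)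
      have := hlt a
      simp only [Nat.succ_eq_add_one] at *
      omega
    · have hs := (hasSum_nat_add_iff' 1).2 h.hasSum
      have hs2 := hs.mul_left 2
      rw [dbl, if_pos (h.half_lt_iff.2 h1)]
      simp only [two_mul_inv_pow (hpos _), Finset.sum_range_one, h1] at hs2
      convert! hs2 using 1
      ring
    · constructor
      · rintro ⟨a, ha⟩
        cases a with
        | zero => omega
        | succ a => exact ⟨a, by dsimp only; omega⟩
      · rintro ⟨a, ha⟩
        have := hlt a
        exact ⟨a + 1, by dsimp only at ha; omega⟩
  · refine ⟨fun k => n k - 1, ⟨?_, ?_, ?_⟩, fun k => ?_⟩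
    · have := h.pos
      omega
    · intro a b hab
      have := h.strictMono hab
      have := hpos a
      dsimp only
      omega
    · have hs2 := h.hasSum.mul_left 2
      rw [dbl, if_neg (mt h.half_lt_iff.1 h1)]
      simpa only [two_mul_inv_pow (hpos _)] using hs2
    · constructor
      · rintro ⟨a, ha⟩
        exact ⟨a, by dsimp only; omega⟩
      · rintro ⟨a, ha⟩
        have := hpos a
        exact ⟨a, by dsimp only at ha; omega⟩

theorem IsBinaryExpansion.mem_range_iff {n : ℕ → ℕ} {x : ℝ} (h : IsBinaryExpansion n x) (k : ℕ) :
    k + 1 ∈ Set.range n ↔ 1 / 2 < dbl^[k] x := by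
  induction k generalizing n x with
  | zero =>
    rw [Function.iterate_zero_apply, h.half_lt_iff]
    constructor
    · rintro ⟨a, ha⟩
      have := le_of_strictMono h.strictMono a
      have := h.pos
      omega
    · exact fun h1 => ⟨0, h1⟩
  | succ k ih =>
    obtain ⟨n', hn', hk⟩ := h.exists_dbl
    rw [Function.iterate_succ_apply, ← ih hn', ← hk]

/-! ### Graph energies along words -/

/-- The sum of a function over all words of length `m`. -/
noncomputable def wordSum (m : ℕ) (φ : List (Fin 3) → ℝ) : ℝ :=
  ∑ w : Fin m → Fin 3, φ (List.ofFn w)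

theorem wordSum_zero (φ : List (Fin 3) → ℝ) : wordSum 0 φ = φ [] := by
  simp [wordSum]

theorem wordSum_succ (m : ℕ) (φ : List (Fin 3) → ℝ) :
    wordSum (m + 1) φ = ∑ i, wordSum m fun w => φ (i :: w) := by
  unfold wordSum
  rw [← (Fin.consEquiv fun _ : Fin (m + 1) => Fin 3).sum_comp, Fintype.sum_prod_type]
  refine Finset.sum_congr rfl fun i _ => Finset.sum_congr rfl fun w _ => ?_
  simp [Fin.consEquiv]

theorem wordSum_nonneg (m : ℕ) {φ : List (Fin 3) → ℝ} (h : ∀ w, 0 ≤ φ w) : 0 ≤ wordSum m φ :=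
  Finset.sum_nonneg fun _ _ => h _

theorem le_wordSum {φ : List (Fin 3) → ℝ} (h : ∀ w, 0 ≤ φ w) (w : List (Fin 3)) :
    φ w ≤ wordSum w.length φ := by
  have := Finset.single_le_sum (f := fun v : Fin w.length → Fin 3 => φ (List.ofFn v))
    (fun _ _ => h _) (Finset.mem_univ w.get)
  simpa [wordSum] using this

/-- The sum of the squared differences along the edges of a triangle with vertex values `a`. -/
def edgeSq (a : Fin 3 → ℝ) : ℝ := (a 0 - a 1) ^ 2 + (a 1 - a 2) ^ 2 + (a 2 - a 0) ^ 2

theorem edgeSq_nonneg (a : Fin 3 → ℝ) : 0 ≤ edgeSq a := by unfold edgeSq; positivity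

theorem sq_sub_le_edgeSq (a : Fin 3 → ℝ) (i j : Fin 3) : (a i - a j) ^ 2 ≤ edgeSq a := by
  unfold edgeSq
  fin_cases i <;> fin_cases j <;> simp <;>
    nlinarith [sq_nonneg (a 0 - a 1), sq_nonneg (a 1 - a 2), sq_nonneg (a 2 - a 0)]

/-- The renormalized graph energy of level `m` of data `a w i`, the values at the vertices
`cellMap w (q i)`. -/
noncomputable def dataEnergy (a : List (Fin 3) → Fin 3 → ℝ) (m : ℕ) : ℝ :=
  (5 / 3) ^ m * wordSum m fun w => edgeSq (a w)

theorem dataEnergy_zero (a : List (Fin 3) → Fin 3 → ℝ) : dataEnergy a 0 = edgeSq (a []) := by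
  simp [dataEnergy, wordSum_zero]

theorem dataEnergy_succ (a : List (Fin 3) → Fin 3 → ℝ) (m : ℕ) :
    dataEnergy a (m + 1) = 5 / 3 * (dataEnergy (fun w => a (0 :: w)) m
      + dataEnergy (fun w => a (1 :: w)) m + dataEnergy (fun w => a (2 :: w)) m) := by
  simp only [dataEnergy, wordSum_succ, Fin.sum_univ_three, pow_succ]
  ring

theorem dataEnergy_nonneg (a : List (Fin 3) → Fin 3 → ℝ) (m : ℕ) : 0 ≤ dataEnergy a m :=
  mul_nonneg (by positivity) (wordSum_nonneg m fun _ => edgeSq_nonneg _)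

theorem edgeSq_le_dataEnergy (a : List (Fin 3) → Fin 3 → ℝ) (w : List (Fin 3)) :
    (5 / 3) ^ w.length * edgeSq (a w) ≤ dataEnergy a w.length := by
  unfold dataEnergy
  gcongr
  exact le_wordSum (φ := fun w => edgeSq (a w)) (fun _ => edgeSq_nonneg _) w

/-- The values of a function at the vertices of the cells. -/
noncomputable def vertexData (f : Plane → ℝ) (w : List (Fin 3)) (i : Fin 3) : ℝ :=
  f (cellMap w (q i))

theorem vertexData_cons (f : Plane → ℝ) (i : Fin 3) :
    (fun w => vertexData f (i :: w)) = vertexData (f ∘ F i) := rfl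

/-- The graph energy on `A` of a function defined on the whole plane. -/
noncomputable def domEnergy (A : Set Plane) (f : Plane → ℝ) (m : ℕ) : ℝ :=
  open Classical in
  (5 / 3) ^ m * wordSum m fun w => if cell w ⊆ A then edgeSq (vertexData f w) else 0

theorem graphEnergy_eq_domEnergy {A : Set Plane} {u : A → ℝ} {f : Plane → ℝ}
    (h : ∀ p (hp : p ∈ A), u ⟨p, hp⟩ = f p) (m : ℕ) : graphEnergy A u m = domEnergy A f m := by
  simp only [graphEnergy, domEnergy, wordSum, cellEnergy, h]
  rfl

theorem domEnergy_SG (f : Plane → ℝ) (m : ℕ) : domEnergy SG f m = dataEnergy (vertexData f) m := by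
  simp [domEnergy, dataEnergy, cell_subset]

theorem domEnergy_nonneg (A : Set Plane) (f : Plane → ℝ) (m : ℕ) : 0 ≤ domEnergy A f m := by
  refine mul_nonneg (by positivity) (wordSum_nonneg m fun w => ?_)
  split_ifs
  · exact edgeSq_nonneg _
  · exact le_rfl

theorem domEnergy_congr {A B : Set Plane} {f g : Plane → ℝ} (hAB : ∀ p ∈ SG, p ∈ A ↔ p ∈ B)
    (hfg : ∀ p ∈ A, p ∈ SG → f p = g p) (m : ℕ) : domEnergy A f m = domEnergy B g m := by
  unfold domEnergy
  congr 2
  funext w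
  have hiff : cell w ⊆ A ↔ cell w ⊆ B :=
    forall₂_congr fun p hp => hAB p (cell_subset w hp)
  by_cases h : cell w ⊆ A
  · rw [if_pos h, if_pos (hiff.1 h)]
    congr 1
    funext i
    exact hfg _ (h (vertex_mem_cell w i)) (cellMap_q_mem w i)
  · rw [if_neg h, if_neg (mt hiff.2 h)]

theorem domEnergy_empty {A : Set Plane} (hA : ∀ p ∈ SG, p ∉ A) (f : Plane → ℝ) (m : ℕ) :
    domEnergy A f m = 0 := by
  have h : ∀ w, ¬ cell w ⊆ A := fun w h =>
    hA _ (cellMap_q_mem w 0) (h (vertex_mem_cell w 0))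
  simp [domEnergy, h, wordSum]

theorem domEnergy_succ (A : Set Plane) (f : Plane → ℝ) (m : ℕ) :
    domEnergy A f (m + 1) = 5 / 3 * (domEnergy (F 0 ⁻¹' A) (f ∘ F 0) m
      + domEnergy (F 1 ⁻¹' A) (f ∘ F 1) m + domEnergy (F 2 ⁻¹' A) (f ∘ F 2) m) := by
  classical
  simp only [domEnergy, wordSum_succ, Fin.sum_univ_three, pow_succ, cell_cons,
    Set.image_subset_iff, ← vertexData_cons]
  ring

theorem domEnergy_Omega_succ_of_lt {x : ℝ} (hx : 1 / 2 < x) (f : Plane → ℝ) (m : ℕ) :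
    domEnergy (Omega x) f (m + 1) = 5 / 3 * (dataEnergy (vertexData (f ∘ F 0)) m
      + domEnergy (Omega (dbl x)) (f ∘ F 1) m + domEnergy (Omega (dbl x)) (f ∘ F 2) m) := by
  rw [domEnergy_succ, ← domEnergy_SG]
  congr 2
  · congr 1
    · exact domEnergy_congr (fun p hp => iff_of_true (F_zero_mem_Omega hx hp) hp)
        (fun _ _ _ => rfl) m
    · exact domEnergy_congr (fun p hp => F_mem_Omega_iff hx (by decide) hp) (fun _ _ _ => rfl) m
  · exact domEnergy_congr (fun p hp => F_mem_Omega_iff hx (by decide) hp) (fun _ _ _ => rfl) m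

theorem domEnergy_Omega_succ_of_not_lt {x : ℝ} (hx : ¬ 1 / 2 < x) (f : Plane → ℝ) (m : ℕ) :
    domEnergy (Omega x) f (m + 1) = 5 / 3 * domEnergy (Omega (dbl x)) (f ∘ F 0) m := by
  rw [domEnergy_succ,
    domEnergy_empty (A := F 1 ⁻¹' Omega x) (fun p hp => F_notMem_Omega hx (by decide) hp),
    domEnergy_empty (A := F 2 ⁻¹' Omega x) (fun p hp => F_notMem_Omega hx (by decide) hp),
    domEnergy_congr (A := F 0 ⁻¹' Omega x) (B := Omega (dbl x)) (g := f ∘ F 0)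
      (fun p hp => F_zero_mem_Omega_iff hx hp) (fun _ _ _ => rfl), add_zero, add_zero]

/-- The energy of a triangle is at most the renormalized energy of its three subtriangles. -/
theorem edgeSq_le_subdivision (f : Plane → ℝ) :
    edgeSq (f ∘ q) ≤
      5 / 3 * (edgeSq (f ∘ F 0 ∘ q) + edgeSq (f ∘ F 1 ∘ q) + edgeSq (f ∘ F 2 ∘ q)) := by
  simp only [edgeSq, Function.comp_apply, F_q_self, F_q_comm 1 0, F_q_comm 2 0, F_q_comm 2 1]
  set a := f (q 0)
  set b := f (q 1)
  set c := f (q 2)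
  set x := f (F 0 (q 1))
  set y := f (F 0 (q 2))
  set z := f (F 1 (q 2))
  -- The right side minus the left is a positive form in the deviations of the midpoint values
  -- from those of the minimizer given by the `1/5`-`2/5` rule.
  nlinarith [sq_nonneg (5 * x - (2 * a + 2 * b + c)), sq_nonneg (5 * y - (2 * a + 2 * c + b)),
    sq_nonneg (5 * z - (2 * b + 2 * c + a)),
    sq_nonneg (5 * x - (2 * a + 2 * b + c) - (5 * y - (2 * a + 2 * c + b))),
    sq_nonneg (5 * y - (2 * a + 2 * c + b) - (5 * z - (2 * b + 2 * c + a))),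
    sq_nonneg (5 * z - (2 * b + 2 * c + a) - (5 * x - (2 * a + 2 * b + c)))]

theorem edgeSq_le_dataEnergy_vertexData (f : Plane → ℝ) (m : ℕ) :
    edgeSq (f ∘ q) ≤ dataEnergy (vertexData f) m := by
  induction m generalizing f with
  | zero => rw [dataEnergy_zero]; rfl
  | succ m ih =>
    rw [dataEnergy_succ]
    refine (edgeSq_le_subdivision f).trans ?_
    have h0 := ih (f ∘ F 0)
    have h1 := ih (f ∘ F 1)
    have h2 := ih (f ∘ F 2)
    simp only [vertexData_cons]
    gcongr <;> assumption

/-! ### Extending vertex data of finite energy -/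

/-- Data `a w i`, meant as values at the points `cellMap w (q i)`, agree at the points that are
vertices of several cells. -/
structure Compatible (a : List (Fin 3) → Fin 3 → ℝ) : Prop where
  corner : ∀ w i, a (w ++ [i]) i = a w i
  junction : ∀ w i j, a (w ++ [i]) j = a (w ++ [j]) i

theorem compatible_vertexData (f : Plane → ℝ) : Compatible (vertexData f) where
  corner w i := by simp [vertexData, cellMap_append, cellMap, F_q_self]
  junction w i j := by simp [vertexData, cellMap_append, cellMap, F_q_comm i j]

theorem Compatible.cons {a : List (Fin 3) → Fin 3 → ℝ} (ha : Compatible a) (i : Fin 3) :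
    Compatible fun w => a (i :: w) :=
  ⟨fun w => ha.corner (i :: w), fun w => ha.junction (i :: w)⟩

theorem Compatible.replicate {a : List (Fin 3) → Fin 3 → ℝ} (ha : Compatible a)
    (w : List (Fin 3)) (i : Fin 3) (m : ℕ) : a (w ++ List.replicate m i) i = a w i := by
  induction m with
  | zero => simp
  | succ m ih => rw [List.replicate_succ', ← List.append_assoc, ha.corner, ih]

/-- At each order, `q j` lies only in the cell of the word `j ⋯ j`, so `corner` applies. -/
theorem Compatible.eq_of_q_mem {a : List (Fin 3) → Fin 3 → ℝ} (ha : Compatible a)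
    {w : List (Fin 3)} {i j : Fin 3} (h : cellMap w (q i) = q j) : a w i = a [] j := by
  induction w generalizing a with
  | nil => rw [q_injective h]
  | cons k w ih =>
    obtain ⟨rfl, h'⟩ : k = j ∧ cellMap w (q i) = q j := by
      have hb := congrArg (bary j) h
      change bary j (F k (cellMap w (q i))) = _ at hb
      rw [bary_F, bary_q, if_pos rfl] at hb
      have hp : cellMap w (q i) = q j :=
        eq_q_of_one_le_bary (cellMap_q_mem w i) (by split_ifs at hb <;> linarith)
      refine ⟨?_, hp⟩
      by_contra hkj
      rw [hp, bary_q, if_pos rfl, if_neg (Ne.symm hkj)] at hb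
      norm_num at hb
    exact (ih (ha.cons k) h').trans (ha.corner [] k)

theorem Compatible.eq_of_length_eq {a : List (Fin 3) → Fin 3 → ℝ} (ha : Compatible a)
    {w v : List (Fin 3)} (hl : w.length = v.length) {i j : Fin 3}
    (h : cellMap w (q i) = cellMap v (q j)) : a w i = a v j := by
  induction w generalizing v a with
  | nil =>
    obtain rfl := List.eq_nil_of_length_eq_zero hl.symm
    rw [q_injective h]
  | cons k w ih =>
    cases v with
    | nil => simp at hl
    | cons l v =>
      by_cases hkl : k = l
      · subst hkl
        exact ih (ha.cons k) (by simpa using hl) (F_injective k h)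
      · obtain ⟨h1, h2⟩ := eq_q_of_F_eq_F hkl (cellMap_q_mem w i) (cellMap_q_mem v j) h
        exact ((ha.cons k).eq_of_q_mem h1).trans
          ((ha.junction [] k l).trans ((ha.cons l).eq_of_q_mem h2).symm)

/-- Every vertex is a vertex of a cell of any given larger order. -/
theorem cellMap_append_replicate (w : List (Fin 3)) (i : Fin 3) (m : ℕ) :
    cellMap (w ++ List.replicate m i) (q i) = cellMap w (q i) := by
  rw [cellMap_append, cellMap_replicate]

theorem Compatible.eq_of_eq {a : List (Fin 3) → Fin 3 → ℝ} (ha : Compatible a)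
    {w v : List (Fin 3)} {i j : Fin 3} (h : cellMap w (q i) = cellMap v (q j)) :
    a w i = a v j := by
  rw [← ha.replicate w i v.length, ← ha.replicate v j w.length]
  refine ha.eq_of_length_eq (by simp [add_comm]) ?_
  rw [cellMap_append_replicate, cellMap_append_replicate, h]

theorem Compatible.exists_fun {a : List (Fin 3) → Fin 3 → ℝ} (ha : Compatible a) :
    ∃ f : Plane → ℝ, ∀ w i, f (cellMap w (q i)) = a w i := by
  classical
  refine ⟨fun p => if h : ∃ (w : List (Fin 3)) (i : Fin 3), p = cellMap w (q i) then
    a h.choose h.choose_spec.choose else 0, fun w i => ?_⟩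
  have h : ∃ (v : List (Fin 3)) (j : Fin 3), cellMap w (q i) = cellMap v (q j) := ⟨w, i, rfl⟩
  simp only [dif_pos h]
  exact (ha.eq_of_eq h.choose_spec.choose_spec).symm

/-- Data of bounded energy oscillate by `O((3/5) ^ (m/2))` on the cells of order `m`: telescope
along a chain of nested cells. -/
theorem Compatible.exists_oscillation_le {a : List (Fin 3) → Fin 3 → ℝ} (ha : Compatible a)
    {B : ℝ} (hB : ∀ m, dataEnergy a m ≤ B) :
    ∃ K, ∀ v w i j, |a (w ++ v) i - a w j| ≤ K * √(3 / 5) ^ w.length := by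
  set ρ := √(3 / 5 : ℝ)
  have hρ0 : 0 ≤ ρ := Real.sqrt_nonneg _
  have hρ1 : ρ < 1 := by
    rw [Real.sqrt_lt' one_pos]
    norm_num
  have hB0 : 0 ≤ B := (dataEnergy_nonneg a 0).trans (hB 0)
  have hedge : ∀ w i j, |a w i - a w j| ≤ √B * ρ ^ w.length := by
    intro w i j
    refine abs_le_of_sq_le_sq ?_ (by positivity)
    have h1 := (edgeSq_le_dataEnergy a w).trans (hB _)
    have h2 := sq_sub_le_edgeSq (a w) i j
    have h3 : (ρ ^ w.length) ^ 2 = (3 / 5) ^ w.length := by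
      rw [← pow_mul, mul_comm, pow_mul, Real.sq_sqrt (by norm_num)]
    have h4 : (3 / 5 : ℝ) ^ w.length * (5 / 3) ^ w.length = 1 := by
      rw [← mul_pow]
      norm_num
    rw [mul_pow, Real.sq_sqrt hB0, h3]
    calc (a w i - a w j) ^ 2 ≤ edgeSq (a w) := h2
      _ = (3 / 5) ^ w.length * ((5 / 3) ^ w.length * edgeSq (a w)) := by
          rw [← mul_assoc, h4, one_mul]
      _ ≤ (3 / 5) ^ w.length * B := by gcongr
      _ = _ := mul_comm _ _
  have h1ρ : 0 < 1 - ρ := by linarith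
  refine ⟨√B / (1 - ρ), fun v => ?_⟩
  have hK : √B + √B / (1 - ρ) * ρ = √B / (1 - ρ) := by
    field_simp
    ring
  induction v with
  | nil =>
    intro w i j
    rw [List.append_nil]
    refine (hedge w i j).trans ?_
    gcongr
    rw [← hK]
    have : 0 ≤ √B / (1 - ρ) * ρ := by positivity
    linarith
  | cons k v ih =>
    intro w i j
    have h1 := ih (w ++ [k]) i k
    rw [ha.corner, List.append_assoc, List.singleton_append, List.length_append,
      List.length_singleton, pow_succ] at h1
    calc |a (w ++ k :: v) i - a w j| ≤ |a (w ++ k :: v) i - a w k| + |a w k - a w j| :=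
          abs_sub_le _ _ _
      _ ≤ √B / (1 - ρ) * (ρ ^ w.length * ρ) + √B * ρ ^ w.length := add_le_add h1 (hedge _ _ _)
      _ = (√B + √B / (1 - ρ) * ρ) * ρ ^ w.length := by ring
      _ = _ := by rw [hK]

/-- Near a point of the gasket only the cells of order `m` containing the point are met. -/
theorem eventually_mem_cell (p : Plane) (m : ℕ) :
    ∀ᶠ r in nhds p, ∀ w : List (Fin 3), w.length = m → r ∈ cell w → p ∈ cell w := by
  have h : ∀ᶠ r in nhds p, ∀ w : Fin m → Fin 3,
      r ∈ cell (List.ofFn w) → p ∈ cell (List.ofFn w) := by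
    rw [Filter.eventually_all]
    intro w
    by_cases hp : p ∈ cell (List.ofFn w)
    · exact Filter.Eventually.of_forall fun _ _ => hp
    · filter_upwards [(isClosed_cell (List.ofFn w)).isOpen_compl.mem_nhds hp] with r hr hr'
      exact absurd hr' hr
  filter_upwards [h] with r hr w hw hrw
  subst hw
  have := hr w.get
  rw [List.ofFn_get] at this
  exact this hrw

/-- Compatible vertex data of bounded energy extend to a continuous function. -/
theorem Compatible.exists_continuous {a : List (Fin 3) → Fin 3 → ℝ} (ha : Compatible a)
    {B : ℝ} (hB : ∀ m, dataEnergy a m ≤ B) :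
    ∃ g : Plane → ℝ, ContinuousOn g SG ∧ ∀ w i, g (cellMap w (q i)) = a w i := by
  obtain ⟨f, hf⟩ := ha.exists_fun
  obtain ⟨K, hK⟩ := ha.exists_oscillation_le hB
  have hρ1 : √(3 / 5 : ℝ) < 1 := by
    rw [Real.sqrt_lt' one_pos]
    norm_num
  -- A vertex lying near `p` lies in a cell of order `m` through `p`.
  have hnear : ∀ p m, ∀ᶠ r in nhdsWithin p Vert, ∃ (w v : List (Fin 3)) (i : Fin 3),
      w.length = m ∧ p ∈ cell w ∧ r = cellMap (w ++ v) (q i) := by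
    intro p m
    filter_upwards [self_mem_nhdsWithin, nhdsWithin_le_nhds (eventually_mem_cell p m)]
    rintro _ ⟨z, i, rfl⟩ hr
    have hz := cellMap_append_replicate z i m
    have hsplit := List.take_append_drop m (z ++ List.replicate m i)
    have hlen : ((z ++ List.replicate m i).take m).length = m := by
      simp
    refine ⟨(z ++ List.replicate m i).take m, (z ++ List.replicate m i).drop m, i, hlen,
      hr _ hlen ?_, ?_⟩
    · rw [← hz, ← hsplit, cellMap_append, hsplit]
      exact ⟨_, cellMap_q_mem _ _, rfl⟩
    · rw [hsplit, hz]
  have hcauchy : ∀ p ∈ SG, ∃ y, Filter.Tendsto f (nhdsWithin p Vert) (nhds y) := by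
    intro p hp
    have : (nhdsWithin p Vert).NeBot := mem_closure_iff_nhdsWithin_neBot.1 hp
    refine cauchy_map_iff_exists_tendsto.1 (Metric.cauchy_iff.2 ⟨inferInstance, fun ε hε => ?_⟩)
    have hlim : Filter.Tendsto (fun m : ℕ => 2 * (K * √(3 / 5 : ℝ) ^ m)) Filter.atTop (nhds 0) := by
      simpa using ((tendsto_pow_atTop_nhds_zero_of_lt_one (Real.sqrt_nonneg _) hρ1).const_mul
        K).const_mul 2
    obtain ⟨m, hm⟩ := (hlim.eventually_lt_const hε).exists
    refine ⟨f '' {r | ∃ (w v : List (Fin 3)) (i : Fin 3), w.length = m ∧ p ∈ cell w ∧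
      r = cellMap (w ++ v) (q i)},
      Filter.image_mem_map (hnear p m), ?_⟩
    rintro _ ⟨_, ⟨w, v, i, hw, hpw, rfl⟩, rfl⟩ _ ⟨_, ⟨w', v', i', hw', hpw', rfl⟩, rfl⟩
    rw [hf, hf, Real.dist_eq]
    refine lt_of_le_of_lt ?_ hm
    obtain ⟨j, j', hj⟩ : ∃ j j', a w j = a w' j' := by
      by_cases heq : w = w'
      · subst heq
        exact ⟨0, 0, rfl⟩
      · obtain ⟨j, j', h1, h2⟩ := eq_vertex_of_mem_cells (hw.trans hw'.symm) heq hpw hpw'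
        exact ⟨j, j', ha.eq_of_eq (h1.symm.trans h2)⟩
    have h1 := hK v w i j
    have h2 := hK v' w' i' j'
    rw [hw] at h1
    rw [hw', ← hj, abs_sub_comm] at h2
    linarith [abs_sub_le (a (w ++ v) i) (a w j) (a (w' ++ v') i')]
  refine ⟨extendFrom Vert f, continuousOn_extendFrom le_rfl hcauchy, fun w i => ?_⟩
  obtain ⟨y, hy⟩ := hcauchy _ (cellMap_q_mem w i)
  have hV : cellMap w (q i) ∈ Vert := ⟨w, i, rfl⟩
  have hpure : Filter.Tendsto f (pure (cellMap w (q i))) (nhds y) :=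
    hy.mono_left (pure_le_nhdsWithin hV)
  rw [extendFrom_eq (subset_closure hV) hy, ← hf w i]
  exact (tendsto_nhds_unique hpure (tendsto_pure_nhds f _))

/-! ### Harmonic data -/

/-- The `1/5`-`2/5` rule: the values at the vertices of the subcell `i` of the harmonic function
with vertex values `a`. -/
noncomputable def harmStep (a : Fin 3 → ℝ) (i j : Fin 3) : ℝ :=
  if j = i then a i else (a 0 + a 1 + a 2 + a i + a j) / 5

/-- The values of the harmonic function with values `a` at `q 0, q 1, q 2`. -/
noncomputable def harm : (Fin 3 → ℝ) → List (Fin 3) → Fin 3 → ℝ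
  | a, [] => a
  | a, i :: w => harm (harmStep a i) w

theorem compatible_harm (a : Fin 3 → ℝ) : Compatible (harm a) := by
  suffices h : (∀ w a i, harm a (w ++ [i]) i = harm a w i) ∧
      ∀ w a i j, harm a (w ++ [i]) j = harm a (w ++ [j]) i from ⟨fun w => h.1 w a, fun w => h.2 w a⟩
  constructor
  · intro w
    induction w with
    | nil => intro a i; simp [harm, harmStep]
    | cons k w ih => exact fun a i => ih (harmStep a k) i
  · intro w
    induction w with
    | nil =>
      intro a i j
      by_cases h : i = j
      · rw [h]
      · simp only [List.nil_append, harm, harmStep, if_neg h, if_neg (Ne.symm h)]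
        ring
    | cons k w ih => exact fun a i j => ih (harmStep a k) i j

theorem dataEnergy_harm (a : Fin 3 → ℝ) (m : ℕ) : dataEnergy (harm a) m = edgeSq a := by
  induction m generalizing a with
  | zero => rw [dataEnergy_zero]; rfl
  | succ m ih =>
    rw [dataEnergy_succ]
    change 5 / 3 * (dataEnergy (harm (harmStep a 0)) m + dataEnergy (harm (harmStep a 1)) m
      + dataEnergy (harm (harmStep a 2)) m) = edgeSq a
    rw [ih, ih, ih]
    simp [edgeSq, harmStep]
    ring

/-! ### The extension operator -/

/-- Vertex data of an extension of `u` from `Omega x` to the gasket that takes the value `c` at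
both bottom vertices. If the first digit of `x` is `1`, this is `u` on the top subcell and the
same construction with the same `c` on the two others. If it is `0`, the top subcell is extended
with the constant `u (q 0)`, and harmonic functions join this constant to `c` on the two others. -/
noncomputable def extData : ℝ → (Plane → ℝ) → ℝ → List (Fin 3) → Fin 3 → ℝ
  | _, u, c, [] => ![u (q 0), c, c]
  | x, u, c, i :: w =>
    open Classical in
    if 1 / 2 < x then
      if i = 0 then vertexData (u ∘ F 0) w else extData (dbl x) (u ∘ F i) c w
    else
      if i = 0 then extData (dbl x) (u ∘ F 0) (u (q 0)) w else harm ![u (q 0), c, c] w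

theorem extData_nil (x : ℝ) (u : Plane → ℝ) (c : ℝ) : extData x u c [] = ![u (q 0), c, c] := rfl

theorem extData_top_of_lt {x : ℝ} (hx : 1 / 2 < x) (u : Plane → ℝ) (c : ℝ) :
    (fun w => extData x u c (0 :: w)) = vertexData (u ∘ F 0) := by
  funext w
  rw [extData, if_pos hx, if_pos rfl]

theorem extData_bottom_of_lt {x : ℝ} (hx : 1 / 2 < x) (u : Plane → ℝ) (c : ℝ) {i : Fin 3}
    (hi : i ≠ 0) : (fun w => extData x u c (i :: w)) = extData (dbl x) (u ∘ F i) c := by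
  funext w
  rw [extData, if_pos hx, if_neg hi]

theorem extData_top_of_not_lt {x : ℝ} (hx : ¬ 1 / 2 < x) (u : Plane → ℝ) (c : ℝ) :
    (fun w => extData x u c (0 :: w)) = extData (dbl x) (u ∘ F 0) (u (q 0)) := by
  funext w
  rw [extData, if_neg hx, if_pos rfl]

theorem extData_bottom_of_not_lt {x : ℝ} (hx : ¬ 1 / 2 < x) (u : Plane → ℝ) (c : ℝ) {i : Fin 3}
    (hi : i ≠ 0) : (fun w => extData x u c (i :: w)) = harm ![u (q 0), c, c] := by
  funext w
  rw [extData, if_neg hx, if_neg hi]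

theorem compatible_extData (x : ℝ) (u : Plane → ℝ) (c : ℝ) : Compatible (extData x u c) := by
  have hfirst : ∀ x u c, (∀ i, extData x u c [i] i = extData x u c [] i) ∧
      ∀ i j, extData x u c [i] j = extData x u c [j] i := by
    intro x u c
    by_cases hx : 1 / 2 < x
    · constructor
      · intro i
        fin_cases i <;> simp [extData, hx, -one_div, vertexData, cellMap, F_q_self]
      · intro i j
        fin_cases i <;> fin_cases j <;>
          simp [extData, hx, -one_div, vertexData, cellMap, F_q_comm 1 0, F_q_comm 2 0]
    · constructor
      · intro i
        fin_cases i <;> simp [extData, hx, -one_div, harm, F_q_self]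
      · intro i j
        fin_cases i <;> fin_cases j <;> simp [extData, hx, -one_div, harm]
  constructor
  · intro w
    induction w generalizing x u c with
    | nil => exact (hfirst x u c).1
    | cons k w ih =>
      intro i
      rw [List.cons_append, extData, extData]
      split_ifs
      · exact (compatible_vertexData _).corner w i
      · exact ih _ _ _ i
      · exact ih _ _ _ i
      · exact (compatible_harm _).corner w i
  · intro w
    induction w generalizing x u c with
    | nil => exact (hfirst x u c).2
    | cons k w ih =>
      intro i j
      rw [List.cons_append, List.cons_append, extData, extData]
      split_ifs
      · exact (compatible_vertexData _).junction w i j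
      · exact ih _ _ _ i j
      · exact ih _ _ _ i j
      · exact (compatible_harm _).junction w i j

theorem extData_eq_of_mem {x : ℝ} (hx1 : x ≤ 1) {u : Plane → ℝ} {c : ℝ} {w : List (Fin 3)}
    {i : Fin 3} (h : cellMap w (q i) ∈ Omega x) : extData x u c w i = u (cellMap w (q i)) := by
  induction w generalizing x u c with
  | nil =>
    by_cases hi : i = 0
    · subst hi
      rfl
    · exact absurd h (q_notMem_Omega hx1 hi)
  | cons k w ih =>
    have hw := cellMap_q_mem w i
    rw [extData]
    split_ifs with hx hk hk
    · subst hk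
      rfl
    · exact ih (dbl_le_one hx1) ((F_mem_Omega_iff hx hk hw).1 h)
    · subst hk
      exact ih (dbl_le_one hx1) ((F_zero_mem_Omega_iff hx hw).1 h)
    · exact absurd h (F_notMem_Omega hx hk hw)

theorem harm_add_smul (s : ℝ) (a b : Fin 3 → ℝ) (w : List (Fin 3)) (i : Fin 3) :
    harm (a + s • b) w i = harm a w i + s * harm b w i := by
  induction w generalizing a b with
  | nil => simp [harm]
  | cons k w ih =>
    have h : harmStep (a + s • b) k = harmStep a k + s • harmStep b k := by
      funext j
      simp only [harmStep, Pi.add_apply, Pi.smul_apply, smul_eq_mul]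
      split_ifs
      · rfl
      · ring
    rw [harm, h, ih]
    rfl

theorem extData_add_smul (x s : ℝ) (u v : Plane → ℝ) (c d : ℝ) (w : List (Fin 3)) (i : Fin 3) :
    extData x (u + s • v) (c + s * d) w i = extData x u c w i + s * extData x v d w i := by
  induction w generalizing x u v c d with
  | nil => fin_cases i <;> simp [extData]
  | cons k w ih =>
    simp only [extData]
    split_ifs
    · rfl
    · exact ih _ _ _ _ _
    · exact ih _ _ _ _ _
    · rw [← harm_add_smul]
      congr 1
      funext j
      fin_cases j <;> simp

/-- The inequality `(d + e)² ≤ (1 + ε) d² + (1 + 1/ε) e²` with `ε = t / (1 + t)`. -/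
theorem weighted_sq_add_le {A t K d e : ℝ} (hA : 0 ≤ A) (ht : 0 < t) (ht2 : t ≤ 1 / 2)
    (hK : 3 * A ≤ K * t) : A * (1 + t) * (d + e) ^ 2 ≤ A * (1 + 2 * t) * d ^ 2 + K * e ^ 2 := by
  refine le_of_mul_le_mul_left ?_ ht
  have h1 : 0 ≤ A * (t * d - (1 + t) * e) ^ 2 := by positivity
  have h2 : A * ((1 + t) * (1 + 2 * t)) * e ^ 2 ≤ K * t * e ^ 2 := by
    refine mul_le_mul_of_nonneg_right (le_trans ?_ hK) (sq_nonneg e)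
    rw [mul_comm 3]
    refine mul_le_mul_of_nonneg_left ?_ hA
    nlinarith
  linarith [h1, h2, show t * (A * (1 + 2 * t) * d ^ 2) + A * ((1 + t) * (1 + 2 * t)) * e ^ 2
    - t * (A * (1 + t) * (d + e) ^ 2) = A * (t * d - (1 + t) * e) ^ 2 by ring]

/-- The energy of `extData x u c` is controlled by that of `u` and the jump `u (q 0) - c`. The
weight of the jump, of order `(10/3) ^ r` if a digit `0` follows within `r` digits `1`, pays for
the `2 ^ r` cells of order `r` along the bottom line in which the jump is bridged. The factor
`1 + 2 ^ r / 2 ^ R` leaves room for the change of the value at the top vertex from one order to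
the next. -/
theorem dataEnergy_extData_le (R m : ℕ) (x : ℝ) (u : Plane → ℝ) (c : ℝ) (r : ℕ) (hr : r ≤ R)
    (hxr : ¬ 1 / 2 < dbl^[r] x) (hR : ∀ k, ∃ s ≤ R, ¬ 1 / 2 < dbl^[k + s] x) :
    dataEnergy (extData x u c) m ≤ (1 + 20 * (10 / 3) ^ R) * domEnergy (Omega x) u m
      + 20 / 3 * (10 / 3) ^ r * (1 + 2 ^ r / 2 ^ R) * (u (q 0) - c) ^ 2 := by
  have hone : ∀ r : ℕ, (20 / 3 : ℝ) ≤ 20 / 3 * (10 / 3) ^ r * (1 + 2 ^ r / 2 ^ R) := by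
    intro r
    have h1 : (1 : ℝ) ≤ (10 / 3) ^ r := one_le_pow₀ (by norm_num)
    have h2 : (1 : ℝ) ≤ 1 + 2 ^ r / 2 ^ R := by
      have : (0 : ℝ) ≤ 2 ^ r / 2 ^ R := by positivity
      linarith
    nlinarith [one_le_mul_of_one_le_of_one_le h1 h2]
  induction m generalizing x u c r with
  | zero =>
    have h1 := mul_le_mul_of_nonneg_right (hone r) (sq_nonneg (u (q 0) - c))
    have h2 : 0 ≤ (1 + 20 * (10 / 3 : ℝ) ^ R) * domEnergy (Omega x) u 0 :=
      mul_nonneg (by positivity) (domEnergy_nonneg _ _ _)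
    rw [dataEnergy_zero, extData_nil]
    simp only [edgeSq, Matrix.cons_val]
    nlinarith [sq_nonneg (u (q 0) - c)]
  | succ m ih =>
    have hR' : ∀ k, ∃ s ≤ R, ¬ 1 / 2 < dbl^[k + s] (dbl x) := by
      intro k
      obtain ⟨s, hs, h⟩ := hR (k + 1)
      refine ⟨s, hs, ?_⟩
      rwa [add_right_comm, Function.iterate_succ_apply] at h
    rw [dataEnergy_succ]
    by_cases hx : 1 / 2 < x
    · cases r with
      | zero => exact absurd hx hxr
      | succ r =>
        rw [Function.iterate_succ_apply] at hxr
        rw [extData_top_of_lt hx, extData_bottom_of_lt hx u c (i := 1) (by decide),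
          extData_bottom_of_lt hx u c (i := 2) (by decide), domEnergy_Omega_succ_of_lt hx]
        have h1 := ih (dbl x) (u ∘ F 1) c r (by omega) hxr hR'
        have h2 := ih (dbl x) (u ∘ F 2) c r (by omega) hxr hR'
        have hS := edgeSq_le_dataEnergy_vertexData (u ∘ F 0) m
        set S := dataEnergy (vertexData (u ∘ F 0)) m
        simp only [edgeSq, Function.comp_apply, F_q_self] at hS
        simp only [Function.comp_apply, F_q_comm 1 0, F_q_comm 2 0] at h1 h2
        set G1 := domEnergy (Omega (dbl x)) (u ∘ F 1) m
        set G2 := domEnergy (Omega (dbl x)) (u ∘ F 2) m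
        have ht : (0 : ℝ) < 2 ^ r / 2 ^ R := by positivity
        have ht2 : (2 : ℝ) ^ r / 2 ^ R ≤ 1 / 2 := by
          have : (2 : ℝ) ^ (r + 1) ≤ 2 ^ R := pow_le_pow_right₀ (by norm_num) hr
          rw [pow_succ] at this
          rw [div_le_div_iff₀ (by positivity) (by norm_num)]
          linarith
        have hA : 0 ≤ 20 / 3 * (10 / 3 : ℝ) ^ r := by positivity
        have hK : 3 * (20 / 3 * (10 / 3 : ℝ) ^ r) ≤ 20 * (10 / 3) ^ R * (2 ^ r / 2 ^ R) := by
          have e1 : (10 / 3 : ℝ) ^ r = (5 / 3) ^ r * 2 ^ r := by rw [← mul_pow]; norm_num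
          have e2 : (10 / 3 : ℝ) ^ R = (5 / 3) ^ R * 2 ^ R := by rw [← mul_pow]; norm_num
          have e3 : (5 / 3 : ℝ) ^ r ≤ (5 / 3) ^ R := pow_le_pow_right₀ (by norm_num) (by omega)
          have e4 : (2 : ℝ) ^ R * (2 ^ r / 2 ^ R) = 2 ^ r := by field_simp
          rw [e1, e2, show 20 * ((5 / 3 : ℝ) ^ R * 2 ^ R) * (2 ^ r / 2 ^ R)
            = 20 * ((5 / 3) ^ R * (2 ^ R * (2 ^ r / 2 ^ R))) by ring, e4]
          have := mul_le_mul_of_nonneg_right e3 (by positivity : (0 : ℝ) ≤ 2 ^ r)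
          linarith
        have hw1 := weighted_sq_add_le (d := u (q 0) - c) (e := u (F 0 (q 1)) - u (q 0))
          hA ht ht2 hK
        have hw2 := weighted_sq_add_le (d := u (q 0) - c) (e := u (F 0 (q 2)) - u (q 0))
          hA ht ht2 hK
        have hsplit : ∀ z, u (q 0) - c + (z - u (q 0)) = z - c := fun z => by ring
        rw [hsplit] at hw1 hw2
        have hSK : 20 * (10 / 3 : ℝ) ^ R * ((u (F 0 (q 1)) - u (q 0)) ^ 2
            + (u (F 0 (q 2)) - u (q 0)) ^ 2) ≤ 20 * (10 / 3) ^ R * S :=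
          mul_le_mul_of_nonneg_left
            (by nlinarith [sq_nonneg (u (F 0 (q 1)) - u (F 0 (q 2)))]) (by positivity)
        have hα : 20 / 3 * (10 / 3 : ℝ) ^ (r + 1) * (1 + 2 ^ (r + 1) / 2 ^ R)
            = 10 / 3 * (20 / 3 * (10 / 3) ^ r * (1 + 2 * (2 ^ r / 2 ^ R))) := by
          rw [pow_succ, pow_succ]
          ring
        rw [hα]
        linarith
    · obtain ⟨s, hs, hxs⟩ := hR' 0
      rw [zero_add] at hxs
      rw [extData_top_of_not_lt hx, extData_bottom_of_not_lt hx u c (i := 1) (by decide),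
        extData_bottom_of_not_lt hx u c (i := 2) (by decide), dataEnergy_harm,
        domEnergy_Omega_succ_of_not_lt hx]
      have h0 := ih (dbl x) (u ∘ F 0) (u (q 0)) s hs hxs hR'
      have h1 := mul_le_mul_of_nonneg_right (hone r) (sq_nonneg (u (q 0) - c))
      rw [Function.comp_apply, F_q_self, sub_self] at h0
      simp only [edgeSq, Matrix.cons_val]
      linarith

/-- A function on `A` extended by `0` to the plane. -/
noncomputable def zeroExt {A : Set Plane} (u : A → ℝ) (p : Plane) : ℝ :=
  open Classical in if h : p ∈ A then u ⟨p, h⟩ else 0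

theorem zeroExt_of_mem {A : Set Plane} (u : A → ℝ) {p : Plane} (h : p ∈ A) :
    zeroExt u p = u ⟨p, h⟩ := dif_pos h

theorem zeroExt_add_smul {A : Set Plane} (s : ℝ) (u v : A → ℝ) :
    zeroExt (u + s • v) = zeroExt u + s • zeroExt v := by
  funext p
  by_cases h : p ∈ A <;> simp [zeroExt, h]

theorem graphEnergy_eq_zeroExt {A : Set Plane} (u : A → ℝ) (m : ℕ) :
    graphEnergy A u m = domEnergy A (zeroExt u) m :=
  graphEnergy_eq_domEnergy (fun _ hp => (zeroExt_of_mem u hp).symm) m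

theorem graphEnergy_le_toReal {A : Set Plane} (u : domE A) (m : ℕ) :
    graphEnergy A (u : C(A, ℝ)) m ≤ (energy A (u : C(A, ℝ))).toReal := by
  rw [← ENNReal.ofReal_le_iff_le_toReal (ne_of_lt u.2)]
  exact le_iSup (fun m => ENNReal.ofReal (graphEnergy A (u : C(A, ℝ)) m)) m

theorem energy_le_ofReal {A : Set Plane} {u : A → ℝ} {B : ℝ} (h : ∀ m, graphEnergy A u m ≤ B) :
    energy A u ≤ ENNReal.ofReal B :=
  iSup_le fun m => ENNReal.ofReal_le_ofReal (h m)

theorem ext_of_eq_on_vertices {g h : C(SG, ℝ)}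
    (hgh : ∀ w i, g ⟨cellMap w (q i), cellMap_q_mem w i⟩ = h ⟨cellMap w (q i), cellMap_q_mem w i⟩) :
    g = h := by
  have hd : Dense {p : SG | ∃ w i, p = ⟨cellMap w (q i), cellMap_q_mem w i⟩} := by
    intro p
    rw [closure_subtype]
    refine closure_mono ?_ (SG_eq ▸ p.2 : (p : Plane) ∈ closure Vert)
    rintro _ ⟨w, i, rfl⟩
    exact ⟨_, ⟨w, i, rfl⟩, rfl⟩
  refine DFunLike.coe_injective (Continuous.ext_on hd g.continuous h.continuous ?_)
  rintro _ ⟨w, i, rfl⟩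
  exact hgh w i

/-- Every point of `Omega x` is a limit of vertices in `Omega x`. -/
theorem Omega_subset_closure (x : ℝ) : Omega x ⊆ closure (Vert ∩ Omega x) := by
  intro p hp
  have hopen : IsOpen {r : Plane | 1 - x < bary 0 r} :=
    isOpen_lt continuous_const (continuous_bary 0)
  have h := hopen.inter_closure (t := Vert) ⟨hp.2, hp.1⟩
  refine closure_mono ?_ h
  rintro r ⟨hr, hV⟩
  exact ⟨hV, Vert_subset hV, hr⟩

theorem exists_extensionOperator {x : ℝ} (hx1 : x ≤ 1) {R : ℕ}
    (hR : ∀ k, ∃ s ≤ R, ¬ 1 / 2 < dbl^[k + s] x) :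
    ∃ T : domE (Omega x) →ₗ[ℝ] domE SG, IsExtensionOperator T ∧
      IsBoundedBy T √(1 + 20 * (10 / 3) ^ R) := by
  have hK : (0 : ℝ) ≤ 1 + 20 * (10 / 3) ^ R := by positivity
  have key : ∀ u : domE (Omega x), ∃ g : domE SG,
      (∀ w i, (g : C(SG, ℝ)) ⟨cellMap w (q i), cellMap_q_mem w i⟩
        = extData x (zeroExt (u : C(Omega x, ℝ))) (zeroExt (u : C(Omega x, ℝ)) (q 0)) w i) ∧
      energySeminorm g ≤ √(1 + 20 * (10 / 3) ^ R) * energySeminorm u := by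
    intro u
    set U := zeroExt (u : C(Omega x, ℝ)) with hU
    obtain ⟨s, hs, hxs⟩ := hR 0
    rw [zero_add] at hxs
    have hB : ∀ m, dataEnergy (extData x U (U (q 0))) m
        ≤ (1 + 20 * (10 / 3) ^ R) * (energy (Omega x) (u : C(Omega x, ℝ))).toReal := by
      intro m
      have h := dataEnergy_extData_le R m x U (U (q 0)) s hs hxs hR
      rw [sub_self, zero_pow two_ne_zero, mul_zero, add_zero, hU, ← graphEnergy_eq_zeroExt] at h
      exact h.trans (mul_le_mul_of_nonneg_left (graphEnergy_le_toReal u m) hK)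
    obtain ⟨g, hgc, hg⟩ := (compatible_extData x U (U (q 0))).exists_continuous hB
    have hgE : energy SG (fun p : SG => g p)
        ≤ ENNReal.ofReal ((1 + 20 * (10 / 3) ^ R)
          * (energy (Omega x) (u : C(Omega x, ℝ))).toReal) := by
      refine energy_le_ofReal fun m => ?_
      rw [graphEnergy_eq_domEnergy (f := g) (fun _ _ => rfl), domEnergy_SG,
        show vertexData g = extData x U (U (q 0)) from funext fun w => funext fun i => hg w i]
      exact hB m
    refine ⟨⟨⟨fun p => g p, continuousOn_iff_continuous_domRestrict.1 hgc⟩,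
      hgE.trans_lt ENNReal.ofReal_lt_top⟩, hg, ?_⟩
    unfold energySeminorm
    rw [← Real.sqrt_mul hK]
    exact Real.sqrt_le_sqrt (ENNReal.toReal_le_of_le_ofReal (by positivity) hgE)
  choose T hT hTE using key
  have hlin : ∀ (s : ℝ) u v, T (u + s • v) = T u + s • T v := by
    intro s u v
    refine Subtype.ext (ext_of_eq_on_vertices fun w i => ?_)
    have hz := zeroExt_add_smul s (u : C(Omega x, ℝ)) (v : C(Omega x, ℝ))
    have e := extData_add_smul x s (zeroExt (u : C(Omega x, ℝ))) (zeroExt (v : C(Omega x, ℝ)))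
      (zeroExt (u : C(Omega x, ℝ)) (q 0)) (zeroExt (v : C(Omega x, ℝ)) (q 0)) w i
    rw [← hT, ← hT, ← hz] at e
    refine (hT _ w i).trans (Eq.trans ?_ e)
    have hz0 := congrFun hz (q 0)
    exact congrArg (fun c => extData x _ c w i) hz0
  have h0 : T 0 = 0 := by
    have := hlin 1 0 0
    simpa using this
  refine ⟨⟨⟨T, fun u v => by simpa using hlin 1 u v⟩, fun s u => by
    simpa [h0] using hlin s 0 u⟩, ?_, hTE⟩
  intro u p hp
  change (T u : C(SG, ℝ)) ⟨p, hp.1⟩ = _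
  -- Both sides are continuous on `Omega x` and agree at the vertices in it.
  have hd : Dense {p : Omega x | (p : Plane) ∈ Vert} := by
    intro p
    rw [closure_subtype]
    refine closure_mono ?_ (Omega_subset_closure x p.2)
    rintro r ⟨hV, hr⟩
    exact ⟨⟨r, hr⟩, hV, rfl⟩
  have hcont : Continuous fun p : Omega x => (T u : C(SG, ℝ)) ⟨p, p.2.1⟩ := by fun_prop
  refine congrFun (Continuous.ext_on hd hcont (u : C(Omega x, ℝ)).continuous ?_) ⟨p, hp⟩
  rintro ⟨_, hr⟩ ⟨w, i, rfl⟩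
  change (T u : C(SG, ℝ)) ⟨cellMap w (q i), _⟩ = _
  rw [hT, extData_eq_of_mem hx1 hr, zeroExt_of_mem]

/-! ### Functions without an extension of small energy -/

theorem domEnergy_const {A : Set Plane} {f : Plane → ℝ} {c : ℝ} (h : ∀ p ∈ A, p ∈ SG → f p = c)
    (m : ℕ) : domEnergy A f m = 0 := by
  rw [domEnergy_congr (B := A) (g := fun _ => c) (fun _ _ => Iff.rfl) h]
  simp [domEnergy, edgeSq, vertexData, wordSum]

theorem domEnergy_Omega_zero {x : ℝ} (hx1 : x ≤ 1) (f : Plane → ℝ) :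
    domEnergy (Omega x) f 0 = 0 := by
  have h : ¬ cell [] ⊆ Omega x := fun h =>
    q_notMem_Omega hx1 (i := 1) (by decide) (h (vertex_mem_cell [] 1))
  simp [domEnergy, wordSum_zero, h]

theorem exists_continuousOn_Omega (x : ℝ) (f : Fin 3 → Plane → ℝ)
    (hf : ∀ i j, F i (q j) ∈ Omega x → f i (q j) = f j (q i))
    (hc : ∀ i, ContinuousOn (f i) (F i ⁻¹' Omega x ∩ SG)) :
    ∃ g : Plane → ℝ, ContinuousOn g (Omega x) ∧
      ∀ i, ∀ p ∈ SG, F i p ∈ Omega x → g (F i p) = f i p := by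
  obtain ⟨g, hg⟩ := exists_glue (fun i => F i ⁻¹' Omega x ∩ SG) (fun _ => Set.inter_subset_right) f
    (fun i j h _ => hf i j h.1)
  exact ⟨g, continuousOn_of_comp_F (Omega_subset x) fun i => (hc i).congr fun p hp => hg i p hp,
    fun i p hp h => hg i p ⟨h, hp⟩⟩

theorem cellMap_replicate_mem_Omega {n : ℕ} {x : ℝ} (hx0 : 0 < x)
    (h : ∀ j < n, 1 / 2 < dbl^[j] x) {i : Fin 3} (hi : i ≠ 0) :
    cellMap (List.replicate n i) (q 0) ∈ Omega x := by
  induction n generalizing x with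
  | zero => exact q_zero_mem_Omega hx0
  | succ n ih =>
    refine (F_mem_Omega_iff (h 0 n.succ_pos) hi (cellMap_q_mem _ _)).2
      (ih (dbl_pos hx0) fun j hj => ?_)
    rw [← Function.iterate_succ_apply]
    exact h _ (by omega)

/-- If the first `n + 1` digits of `x` are `1`, the function equal to `1` on the left and to `-1`
on the right lower part of `Omega x` has energy `10`, while an extension to the gasket has to
change by `2` across two cells of order `n + 1` with a common vertex on the bottom line. -/
theorem exists_steep_at_top (n : ℕ) {x : ℝ} (hx0 : 0 < x) (hx1 : x ≤ 1)
    (hrun : ∀ j < n + 1, 1 / 2 < dbl^[j] x) :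
    ∃ u : Plane → ℝ, ContinuousOn u (Omega x) ∧ u (q 0) = 0 ∧
      (∀ m, domEnergy (Omega x) u m ≤ 10) ∧
      ∀ h : Plane → ℝ, (∀ p ∈ Omega x, h p = u p) →
        ∃ m, 2 * (5 / 3) ^ (n + 1) ≤ dataEnergy (vertexData h) m := by
  have hx : 1 / 2 < x := hrun 0 n.succ_pos
  obtain ⟨h0, hh0c, hh0⟩ := (compatible_harm ![0, 1, -1]).exists_continuous
    fun m => (dataEnergy_harm _ m).le
  have e0 : h0 (q 0) = 0 := hh0 [] 0
  have e1 : h0 (q 1) = 1 := hh0 [] 1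
  have e2 : h0 (q 2) = -1 := hh0 [] 2
  have hn12 : F 1 (q 2) ∉ Omega x := fun h =>
    q_notMem_Omega (dbl_le_one hx1) (by decide) ((F_mem_Omega_iff hx (by decide) (q_mem_SG 2)).1 h)
  have hn21 : F 2 (q 1) ∉ Omega x := F_q_comm 1 2 ▸ hn12
  obtain ⟨u, huc, hu⟩ := exists_continuousOn_Omega x ![h0, fun _ => 1, fun _ => -1]
    (by
      intro i j hij
      fin_cases i <;> fin_cases j <;> simp_all)
    (by
      intro i
      fin_cases i
      · exact hh0c.mono Set.inter_subset_right
      · exact continuousOn_const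
      · exact continuousOn_const)
  have hu1 : ∀ p ∈ Omega (dbl x), u (F 1 p) = 1 := fun p hp =>
    hu 1 p hp.1 ((F_mem_Omega_iff hx (by decide) hp.1).2 hp)
  have hu2 : ∀ p ∈ Omega (dbl x), u (F 2 p) = -1 := fun p hp =>
    hu 2 p hp.1 ((F_mem_Omega_iff hx (by decide) hp.1).2 hp)
  refine ⟨u, huc, ?_, fun m => ?_, fun h hh => ⟨n + 1, ?_⟩⟩
  · have := hu 0 (q 0) (q_mem_SG 0) (F_zero_mem_Omega hx (q_mem_SG 0))
    rw [F_q_self] at this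
    exact this.trans e0
  · cases m with
    | zero => rw [domEnergy_Omega_zero hx1]; norm_num
    | succ m =>
      have hv : vertexData (u ∘ F 0) = harm ![0, 1, -1] := by
        funext w i
        rw [← hh0]
        exact hu 0 _ (cellMap_q_mem w i) (F_zero_mem_Omega hx (cellMap_q_mem w i))
      rw [domEnergy_Omega_succ_of_lt hx, hv, dataEnergy_harm,
        domEnergy_const (f := u ∘ F 1) fun p hp _ => hu1 p hp,
        domEnergy_const (f := u ∘ F 2) fun p hp _ => hu2 p hp]
      simp only [edgeSq, Matrix.cons_val]
      norm_num
  · have hrun' : ∀ j < n, 1 / 2 < dbl^[j] (dbl x) := fun j hj => by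
      rw [← Function.iterate_succ_apply]
      exact hrun _ (by omega)
    have hp1 := cellMap_replicate_mem_Omega (dbl_pos hx0) hrun' (i := 2) (by decide)
    have hp2 := cellMap_replicate_mem_Omega (dbl_pos hx0) hrun' (i := 1) (by decide)
    have v1 := (hh _ ((F_mem_Omega_iff hx (i := 1) (by decide) hp1.1).2 hp1)).trans (hu1 _ hp1)
    have v2 := (hh _ ((F_mem_Omega_iff hx (i := 2) (by decide) hp2.1).2 hp2)).trans (hu2 _ hp2)
    have s1 := sq_sub_le_edgeSq (vertexData (h ∘ F 1) (List.replicate n 2)) 0 2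
    have s2 := sq_sub_le_edgeSq (vertexData (h ∘ F 2) (List.replicate n 1)) 0 1
    simp only [vertexData, Function.comp_apply, cellMap_replicate, v1, v2, F_q_comm 2 1] at s1 s2
    have t1 := edgeSq_le_dataEnergy (vertexData (h ∘ F 1)) (List.replicate n 2)
    have t2 := edgeSq_le_dataEnergy (vertexData (h ∘ F 2)) (List.replicate n 1)
    rw [List.length_replicate] at t1 t2
    rw [dataEnergy_succ, vertexData_cons, vertexData_cons, vertexData_cons, pow_succ]
    have t0 := dataEnergy_nonneg (vertexData (h ∘ F 0)) n
    have hsum : 2 ≤ edgeSq (vertexData (h ∘ F 1) (List.replicate n 2))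
        + edgeSq (vertexData (h ∘ F 2) (List.replicate n 1)) :=
      le_trans (by nlinarith [sq_nonneg (h (F 1 (q 2)))]) (add_le_add s1 s2)
    have := mul_le_mul_of_nonneg_left hsum (by positivity : (0 : ℝ) ≤ (5 / 3) ^ n)
    linarith

/-- The function of `exists_steep_at_top`, transported to one cell of order `k` and continued
by `0`, for a run of `n + 1` digits `1` that follows the first `k` digits. -/
theorem exists_steep (n k : ℕ) {x : ℝ} (hx0 : 0 < x) (hx1 : x ≤ 1)
    (hrun : ∀ j < n + 1, 1 / 2 < dbl^[k + j] x) :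
    ∃ u : Plane → ℝ, ContinuousOn u (Omega x) ∧ u (q 0) = 0 ∧
      (∀ m, domEnergy (Omega x) u m ≤ 10 * (5 / 3) ^ k) ∧
      ∀ h : Plane → ℝ, (∀ p ∈ Omega x, h p = u p) →
        ∃ m, 2 * (5 / 3) ^ (n + 1) * (5 / 3) ^ k ≤ dataEnergy (vertexData h) m := by
  induction k generalizing x with
  | zero => simpa using exists_steep_at_top n hx0 hx1 (by simpa using hrun)
  | succ k ih =>
    obtain ⟨v, hvc, hv0, hvE, hvX⟩ := ih (dbl_pos hx0) (dbl_le_one hx1) fun j hj => by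
      have := hrun j hj
      rwa [add_right_comm, Function.iterate_succ_apply] at this
    by_cases hx : 1 / 2 < x
    · have hn12 : F 1 (q 2) ∉ Omega x := fun h => q_notMem_Omega (dbl_le_one hx1) (by decide)
        ((F_mem_Omega_iff hx (by decide) (q_mem_SG 2)).1 h)
      have hn21 : F 2 (q 1) ∉ Omega x := F_q_comm 1 2 ▸ hn12
      obtain ⟨u, huc, hu⟩ := exists_continuousOn_Omega x ![fun _ => 0, v, fun _ => 0]
        (by
          intro i j hij
          fin_cases i <;> fin_cases j <;> simp_all)
        (by
          intro i
          fin_cases i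
          · exact continuousOn_const
          · exact hvc.mono fun p hp => (F_mem_Omega_iff hx (by decide) hp.2).1 hp.1
          · exact continuousOn_const)
      have hu0 : ∀ p ∈ SG, u (F 0 p) = 0 := fun p hp => hu 0 p hp (F_zero_mem_Omega hx hp)
      have hu1 : ∀ p ∈ Omega (dbl x), u (F 1 p) = v p := fun p hp =>
        hu 1 p hp.1 ((F_mem_Omega_iff hx (by decide) hp.1).2 hp)
      have hu2 : ∀ p ∈ Omega (dbl x), u (F 2 p) = 0 := fun p hp =>
        hu 2 p hp.1 ((F_mem_Omega_iff hx (by decide) hp.1).2 hp)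
      refine ⟨u, huc, ?_, fun m => ?_, fun h hh => ?_⟩
      · have := hu0 (q 0) (q_mem_SG 0)
        rwa [F_q_self] at this
      · cases m with
        | zero => rw [domEnergy_Omega_zero hx1]; positivity
        | succ m =>
          rw [domEnergy_Omega_succ_of_lt hx, ← domEnergy_SG,
            domEnergy_const (f := u ∘ F 0) fun p hp _ => hu0 p hp,
            domEnergy_const (f := u ∘ F 2) fun p hp _ => hu2 p hp,
            domEnergy_congr (f := u ∘ F 1) (fun _ _ => Iff.rfl) (fun p hp _ => hu1 p hp), pow_succ]
          linarith [hvE m]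
      · obtain ⟨m, hm⟩ := hvX (h ∘ F 1) fun p hp =>
          (hh _ ((F_mem_Omega_iff hx (by decide) hp.1).2 hp)).trans (hu1 p hp)
        refine ⟨m + 1, ?_⟩
        rw [dataEnergy_succ, vertexData_cons, vertexData_cons, vertexData_cons,
          pow_succ _ k]
        linarith [dataEnergy_nonneg (vertexData (h ∘ F 0)) m,
          dataEnergy_nonneg (vertexData (h ∘ F 2)) m]
    · have hn : ∀ i ≠ 0, ∀ p ∈ SG, F i p ∉ Omega x := fun i hi p hp => F_notMem_Omega hx hi hp
      obtain ⟨u, huc, hu⟩ := exists_continuousOn_Omega x (fun _ => v)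
        (by
          intro i j hij
          by_cases hi : i = 0
          · by_cases hj : j = 0
            · rw [hi, hj]
            · exact absurd (F_q_comm i j ▸ hij) (hn j hj _ (q_mem_SG i))
          · exact absurd hij (hn i hi _ (q_mem_SG j)))
        (by
          intro i
          by_cases hi : i = 0
          · subst hi
            exact hvc.mono fun p hp => (F_zero_mem_Omega_iff hx hp.2).1 hp.1
          · exact fun p hp => absurd hp.1 (hn i hi p hp.2))
      have hu0 : ∀ p ∈ Omega (dbl x), u (F 0 p) = v p := fun p hp =>
        hu 0 p hp.1 ((F_zero_mem_Omega_iff hx hp.1).2 hp)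
      refine ⟨u, huc, ?_, fun m => ?_, fun h hh => ?_⟩
      · have := hu0 (q 0) (q_zero_mem_Omega (dbl_pos hx0))
        rw [F_q_self] at this
        exact this.trans hv0
      · cases m with
        | zero => rw [domEnergy_Omega_zero hx1]; positivity
        | succ m =>
          rw [domEnergy_Omega_succ_of_not_lt hx,
            domEnergy_congr (f := u ∘ F 0) (fun _ _ => Iff.rfl) (fun p hp _ => hu0 p hp), pow_succ]
          linarith [hvE m]
      · obtain ⟨m, hm⟩ := hvX (h ∘ F 0) fun p hp =>
          (hh _ ((F_zero_mem_Omega_iff hx hp.1).2 hp)).trans (hu0 p hp)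
        refine ⟨m + 1, ?_⟩
        rw [dataEnergy_succ, vertexData_cons, vertexData_cons, vertexData_cons,
          pow_succ _ k]
        linarith [dataEnergy_nonneg (vertexData (h ∘ F 1)) m,
          dataEnergy_nonneg (vertexData (h ∘ F 2)) m]

/-! ### The characterization -/

theorem energySeminorm_nonneg {A : Set Plane} (u : domE A) : 0 ≤ energySeminorm u :=
  Real.sqrt_nonneg _

theorem energySeminorm_sq {A : Set Plane} (u : domE A) :
    energySeminorm u ^ 2 = (energy A (u : C(A, ℝ))).toReal :=
  Real.sq_sqrt ENNReal.toReal_nonneg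

/-- The squared norm of an extension operator grows at least like `(5/3) ^ n` in the length
`n + 1` of a run of digits `1`. -/
theorem pow_le_of_isBoundedBy {x : ℝ} (hx0 : 0 < x) (hx1 : x ≤ 1)
    {T : domE (Omega x) →ₗ[ℝ] domE SG} (hT : IsExtensionOperator T) {M : ℝ}
    (hM : IsBoundedBy T M) {n k : ℕ} (hrun : ∀ j < n + 1, 1 / 2 < dbl^[k + j] x) :
    (5 / 3) ^ (n + 1) ≤ 5 * M ^ 2 := by
  obtain ⟨u, huc, -, huE, huX⟩ := exists_steep n k hx0 hx1 hrun
  have hE : energy (Omega x) (fun p : Omega x => u p) ≤ ENNReal.ofReal (10 * (5 / 3) ^ k) :=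
    energy_le_ofReal fun m => by
      rw [graphEnergy_eq_domEnergy (f := u) (fun _ _ => rfl)]
      exact huE m
  let U : domE (Omega x) := ⟨⟨fun p => u p, continuousOn_iff_continuous_domRestrict.1 huc⟩,
    hE.trans_lt ENNReal.ofReal_lt_top⟩
  obtain ⟨m, hm⟩ := huX (zeroExt (T U : C(SG, ℝ))) fun p hp => by
    rw [zeroExt_of_mem _ hp.1]
    exact hT U p hp
  rw [← domEnergy_SG, ← graphEnergy_eq_zeroExt] at hm
  have h1 := hm.trans (graphEnergy_le_toReal (T U) m)
  rw [← energySeminorm_sq] at h1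
  have h2 := pow_le_pow_left₀ (energySeminorm_nonneg _) (hM U) 2
  rw [mul_pow, energySeminorm_sq U] at h2
  have h3 : (energy (Omega x) (U : C(Omega x, ℝ))).toReal ≤ 10 * (5 / 3) ^ k :=
    ENNReal.toReal_le_of_le_ofReal (by positivity) hE
  have h4 := h1.trans (h2.trans (mul_le_mul_of_nonneg_left h3 (sq_nonneg M)))
  refine le_of_mul_le_mul_right (?_ : _ * (2 * (5 / 3 : ℝ) ^ k) ≤ _) (by positivity)
  linarith

theorem exists_isBoundedBy_of_nonconsecutive {x : ℝ} {n : ℕ → ℕ} {N : ℕ}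
    (hn : IsBinaryExpansion n x) (hN : Nonconsecutive n N) :
    ∃ T : domE (Omega x) →ₗ[ℝ] domE SG,
      IsExtensionOperator T ∧ IsBoundedBy T (5 * (10 / 3 : ℝ) ^ ((N : ℝ) / 2)) := by
  have hR : ∀ k, ∃ s ≤ N, ¬ 1 / 2 < dbl^[k + s] x := by
    intro k
    by_contra! h
    refine hN ⟨k + 1, fun i hi => ?_⟩
    rw [add_right_comm, hn.mem_range_iff]
    exact h i hi.le
  obtain ⟨T, hT, hb⟩ := exists_extensionOperator hn.le_one hR
  refine ⟨T, hT, fun u => (hb u).trans ?_⟩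
  refine mul_le_mul_of_nonneg_right (Real.sqrt_le_iff.2 ⟨by positivity, ?_⟩)
    (energySeminorm_nonneg u)
  have h1 : ((10 / 3 : ℝ) ^ ((N : ℝ) / 2)) ^ 2 = (10 / 3) ^ N := by
    rw [← Real.rpow_natCast, ← Real.rpow_mul (by norm_num)]
    norm_num
  have h2 : (1 : ℝ) ≤ (10 / 3) ^ N := one_le_pow₀ (by norm_num)
  rw [mul_pow, h1]
  linarith

end Gasket

theorem theorem4p6 :
    (∀ (x : ℝ) (n : ℕ → ℕ), Gasket.IsBinaryExpansion n x →
      ((∃ T : Gasket.domE (Gasket.Omega x) →ₗ[ℝ] Gasket.domE Gasket.SG,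
          Gasket.IsExtensionOperator T ∧ ∃ M : ℝ, Gasket.IsBoundedBy T M) ↔
        ∃ N : ℕ, Gasket.Nonconsecutive n N)) ∧
    ∃ C : ℝ, 0 < C ∧ ∀ (x : ℝ) (n : ℕ → ℕ) (N : ℕ),
      Gasket.IsBinaryExpansion n x → Gasket.Nonconsecutive n N →
        ∃ T : Gasket.domE (Gasket.Omega x) →ₗ[ℝ] Gasket.domE Gasket.SG,
          Gasket.IsExtensionOperator T ∧
            Gasket.IsBoundedBy T (C * (10 / 3 : ℝ) ^ ((N : ℝ) / 2)) := by
  refine ⟨fun x n hn => ⟨?_, ?_⟩,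
    5, by norm_num, fun x n N => Gasket.exists_isBoundedBy_of_nonconsecutive⟩
  · rintro ⟨T, hT, M, hM⟩
    by_contra! h
    obtain ⟨l, hl⟩ := pow_unbounded_of_one_lt (5 * M ^ 2) (by norm_num : (1 : ℝ) < 5 / 3)
    obtain ⟨a, ha⟩ := not_not.1 (h (l + 1))
    -- All `n k` are positive, so a nonempty run starts at some `k + 1`.
    obtain ⟨k, rfl⟩ : ∃ k, a = k + 1 := by
      obtain ⟨j, hj⟩ := ha 0 l.succ_pos
      have := hn.pos
      have := Gasket.le_of_strictMono hn.strictMono j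
      exact ⟨a - 1, by omega⟩
    have hpow := Gasket.pow_le_of_isBoundedBy hn.x_pos hn.le_one hT hM (n := l) (k := k)
      fun j hj => by
        rw [← hn.mem_range_iff, add_right_comm]
        exact ha j hj
    have : (5 / 3 : ℝ) ^ l ≤ (5 / 3) ^ (l + 1) := pow_le_pow_right₀ (by norm_num) l.le_succ
    linarith
  · rintro ⟨N, hN⟩
    obtain ⟨T, hT, hb⟩ := Gasket.exists_isBoundedBy_of_nonconsecutive hn hN
    exact ⟨T, hT, _, hb⟩
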